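/- Let $H$ be a complex Hilbert space and $T\in B(H)$ a bounded linear operator. Let $w(T)=\sup\{|\langle Tx,x\rangle| : \|x\|=1\}$ be its numerical radius, $|T|=(T^*T)^{1/2}$, and let $T=U|T|$ be the polar decomposition, $U$ being the partial isometry with $\ker U=\ker T$. For $t\in[0,1]$ let $\widetilde T_t=|T|^tU|T|^{1-t}$ be the $t$-Aluthge transform, where $|T|^0:=U^*U$, and let $\widetilde T=\widetilde T_{1/2}=|T|^{1/2}U|T|^{1/2}$. (i) The minimum below is attained and $$w(T)\le\min_{t\in[0,1]}\Big\{\tfrac12 w(\widetilde T_t)+\tfrac14\big(\|T\|^{2t}+\|T\|^{2-2t}\big)\Big\}.\qquad(1)$$ In particular, $$w(T)\le\tfrac12 w(\widetilde T)+\tfrac12\|T\|.\qquad(2)$$ (ii) Suppose that $1\le\dim H<\infty$. For $t\in[0,1]$ consider the conditions (A) $T$ is unitarily similar to $[a]\oplus B$ for some $a\in\mathbb C$ and some square matrix $B$ with $\|B\|\le|a|$; (B$_t$) $T$ is unitarily similar to $\begin{pmatrix}a&0\\ b&0\end{pmatrix}\oplus C$ for some $a,b\in\mathbb C$ and some square matrix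 $C$ with $\|C\|\le(|a|^2+|b|^2)^{1/2}$ and $w(\widetilde C_t)\le|a|$; here the summands $B$ and $C$ may be absent. Equality holds in (2) if and only if (A) or (B$_{1/2}$) holds. Equality holds in (1) if and only if (A) holds, or (B$_t$) holds for some $t\in[0,1]$ such that $t=\tfrac12$ or $\|T\|=1$. (Equality in (2) implies equality in (1), so both equalities hold if and only if (A) or (B$_{1/2}$) holds.) (iii) For an arbitrary Hilbert space $H$, equality holds in both (1) and (2) if $T^2=0$ or if $T$ is normaloid, i.e. $w(T)=\|T\|$. -/

import Mathlib

namespace NumRadius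

section Operators

variable {H : Type*} [NormedAddCommGroup H] [InnerProductSpace ℂ H]

/-- The numerical range `W(T)`: all values `⟨Tx, x⟩` at unit vectors `x`. Mathlib's inner product
is linear in its second variable, so the form `⟨Tx, x⟩` that is linear in `Tx` is `inner ℂ x (T x)`. -/
def numericalRange (T : H →L[ℂ] H) : Set ℂ :=
  {z | ∃ x : H, ‖x‖ = 1 ∧ inner ℂ x (T x) = z}

/-- The numerical radius `w(T) = sup {|λ| : λ ∈ W(T)}` (it is `0` on the zero space). -/
noncomputable def numericalRadius (T : H →L[ℂ] H) : ℝ :=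
  sSup ((fun z : ℂ => ‖z‖) '' numericalRange T)

/-- The set whose supremum is `w(T)` is bounded, so that supremum is a genuine one. -/
theorem bddAbove_numericalRange (T : H →L[ℂ] H) :
    BddAbove ((fun z : ℂ => ‖z‖) '' numericalRange T) := by
  refine ⟨‖T‖, ?_⟩
  rintro _ ⟨z, ⟨x, hx, rfl⟩, rfl⟩
  calc ‖inner ℂ x (T x)‖ ≤ ‖x‖ * ‖T x‖ := norm_inner_le_norm _ _
    _ ≤ ‖x‖ * (‖T‖ * ‖x‖) := by gcongr; exact T.le_opNorm x
    _ = ‖T‖ := by rw [hx]; ring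

/-- A partial isometry: isometric on the orthogonal complement of its kernel. -/
def IsPartialIsometry (U : H →L[ℂ] H) : Prop :=
  ∀ x ∈ (LinearMap.ker U.toLinearMap)ᗮ, ‖U x‖ = ‖x‖

variable [CompleteSpace H]

/-- `U` is the partial isometry of the polar decomposition `T = U|T|`, `ker T = ker U`. -/
def IsPolarFactor (T U : H →L[ℂ] H) : Prop :=
  IsPartialIsometry U ∧ T = U * CFC.abs T ∧
    LinearMap.ker T.toLinearMap = LinearMap.ker U.toLinearMap

theorem norm_abs_apply (T : H →L[ℂ] H) (x : H) : ‖CFC.abs T x‖ = ‖T x‖ := by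
  have h : CFC.abs T * CFC.abs T = star T * T := CFC.abs_mul_abs T
  have hsa : star (CFC.abs T) = CFC.abs T := (CFC.abs_nonneg T).isSelfAdjoint.star_eq
  have h1 : inner ℂ (CFC.abs T x) (CFC.abs T x) = inner ℂ (T x) (T x) := by
    rw [← ContinuousLinearMap.adjoint_inner_right, ← ContinuousLinearMap.adjoint_inner_right,
      ← ContinuousLinearMap.star_eq_adjoint, ← ContinuousLinearMap.star_eq_adjoint, hsa]
    exact congrArg (fun A : H →L[ℂ] H => inner ℂ x (A x)) h
  rw [inner_self_eq_norm_sq_to_K, inner_self_eq_norm_sq_to_K] at h1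
  have h2 : ‖CFC.abs T x‖ ^ 2 = ‖T x‖ ^ 2 := by exact_mod_cast h1
  exact (sq_eq_sq₀ (norm_nonneg _) (norm_nonneg _)).1 h2

theorem ker_abs (T : H →L[ℂ] H) :
    LinearMap.ker (CFC.abs T).toLinearMap = LinearMap.ker T.toLinearMap := by
  ext x
  have := norm_abs_apply T x
  simp only [LinearMap.mem_ker, ContinuousLinearMap.coe_coe]
  rw [← norm_eq_zero, this, norm_eq_zero]

theorem closure_range_abs (T : H →L[ℂ] H) :
    (LinearMap.range (CFC.abs T).toLinearMap).topologicalClosure =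
      (LinearMap.ker T.toLinearMap)ᗮ := by
  have hsa : star (CFC.abs T) = CFC.abs T := (CFC.abs_nonneg T).isSelfAdjoint.star_eq
  rw [← ker_abs, ContinuousLinearMap.orthogonal_ker, ← ContinuousLinearMap.star_eq_adjoint, hsa]

/-- Existence and uniqueness of the polar decomposition. -/
theorem existsUnique_polarFactor (T : H →L[ℂ] H) : ∃! U : H →L[ℂ] H, IsPolarFactor T U := by
  set K : Submodule ℂ H := (LinearMap.ker T.toLinearMap)ᗮ with hK
  have hmem : ∀ x, CFC.abs T x ∈ K := fun x => by
    rw [hK, ← closure_range_abs]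
    exact Submodule.le_topologicalClosure _ ⟨x, rfl⟩
  refine existsUnique_of_exists_of_unique ?_ ?_
  · let e : H →ₗ[ℂ] K := (CFC.abs T).toLinearMap.codRestrict K hmem
    have hd : DenseRange e := by
      intro y
      have hy : (y : H) ∈ closure (LinearMap.range (CFC.abs T).toLinearMap : Set H) := by
        have hle : K ≤ (LinearMap.range (CFC.abs T).toLinearMap).topologicalClosure := by
          rw [closure_range_abs]
        exact hle y.2
      rw [closure_subtype]
      refine closure_mono ?_ hy
      rintro _ ⟨x, rfl⟩
      exact ⟨e x, ⟨x, rfl⟩, rfl⟩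
    have hn : ∀ x, ‖T.toLinearMap x‖ = ‖e x‖ := fun x => (norm_abs_apply T x).symm
    let W : K →L[ℂ] H := T.toLinearMap.extendOfNorm e
    have hW : ∀ x, W (e x) = T x := fun x =>
      LinearMap.extendOfNorm_eq hd ⟨1, fun x => by rw [one_mul, hn]⟩ x
    have hWn : ∀ y, ‖W y‖ = ‖y‖ := by
      intro y
      refine hd.induction_on (p := fun y => ‖W y‖ = ‖y‖) y
        (isClosed_eq (by fun_prop) (by fun_prop)) fun x => ?_
      rw [hW]
      exact hn x
    let U : H →L[ℂ] H := W ∘L K.orthogonalProjectionOnto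
    have hker : LinearMap.ker U.toLinearMap = LinearMap.ker T.toLinearMap := by
      ext x
      have h1 : x ∈ LinearMap.ker U.toLinearMap ↔ K.orthogonalProjectionOnto x = 0 := by
        rw [LinearMap.mem_ker, ← norm_eq_zero, ← norm_eq_zero (a := K.orthogonalProjectionOnto x),
          ← hWn]
        rfl
      rw [h1, Submodule.orthogonalProjectionOnto_eq_zero_iff, hK,
        Submodule.orthogonal_orthogonal_eq_closure,
        (ContinuousLinearMap.isClosed_ker T).submodule_topologicalClosure_eq]
    have hU : ∀ y : K, U y = W y := fun y => by
      change W (K.orthogonalProjectionOnto y) = W y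
      rw [Submodule.orthogonalProjectionOnto_mem_subspace_eq_self]
    refine ⟨U, ?_, ?_, hker.symm⟩
    · intro x hx
      rw [hker] at hx
      have := hU ⟨x, hx⟩
      change U x = _ at this
      rw [this, hWn]
      rfl
    · ext x
      exact (hW x).symm.trans (hU (e x)).symm
  · rintro U V ⟨-, hU, hkU⟩ ⟨-, hV, hkV⟩
    have hz : ∀ x, (U - V) (CFC.abs T x) = 0 := fun x => by
      have h1 : T x = U (CFC.abs T x) := congrArg (fun A : H →L[ℂ] H => A x) hU
      have h2 : T x = V (CFC.abs T x) := congrArg (fun A : H →L[ℂ] H => A x) hV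
      rw [sub_apply, ← h1, ← h2, sub_self]
    have hle : K ≤ LinearMap.ker (U - V).toLinearMap := by
      rw [hK, ← closure_range_abs]
      refine Submodule.topologicalClosure_minimal _ ?_ (ContinuousLinearMap.isClosed_ker (U - V))
      rintro _ ⟨x, rfl⟩
      exact hz x
    have hle2 : LinearMap.ker T.toLinearMap ≤ LinearMap.ker (U - V).toLinearMap := by
      intro x hx
      have h1 : U x = 0 := by rw [hkU] at hx; exact hx
      have h2 : V x = 0 := by rw [hkV] at hx; exact hx
      change (U - V) x = 0
      rw [sub_apply, h1, h2, sub_self]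
    have : CompleteSpace (LinearMap.ker T.toLinearMap) :=
      (ContinuousLinearMap.isClosed_ker T).completeSpace_coe
    have htop : (⊤ : Submodule ℂ H) ≤ LinearMap.ker (U - V).toLinearMap := by
      rw [← Submodule.sup_orthogonal_of_hasOrthogonalProjection
        (K := LinearMap.ker T.toLinearMap)]
      exact sup_le hle2 hle
    rw [← sub_eq_zero]
    ext x
    exact htop (Submodule.mem_top (x := x))

/-- The partial isometry `U` of the polar decomposition `T = U|T|`, `ker T = ker U`. -/
noncomputable def polarFactor (T : H →L[ℂ] H) : H →L[ℂ] H :=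
  (existsUnique_polarFactor T).exists.choose

theorem polarFactor_spec (T : H →L[ℂ] H) : IsPolarFactor T (polarFactor T) :=
  (existsUnique_polarFactor T).exists.choose_spec

open Classical in
/-- The power `|T|^s` for `s ≥ 0`, by functional calculus for `s > 0`, with the convention
`|T|^0 = U*U`. -/
noncomputable def absPow (T : H →L[ℂ] H) (s : ℝ) : H →L[ℂ] H :=
  if s = 0 then star (polarFactor T) * polarFactor T else CFC.abs T ^ s

/-- The `t`-Aluthge transform `|T|^t U |T|^(1-t)`, for `t ∈ [0,1]`. -/
noncomputable def tAluthge (T : H →L[ℂ] H) (t : ℝ) : H →L[ℂ] H :=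
  absPow T t * polarFactor T * absPow T (1 - t)

/-- The Aluthge transform `|T|^(1/2) U |T|^(1/2)`. -/
noncomputable def aluthge (T : H →L[ℂ] H) : H →L[ℂ] H :=
  CFC.abs T ^ (1 / 2 : ℝ) * polarFactor T * CFC.abs T ^ (1 / 2 : ℝ)

theorem tAluthge_half (T : H →L[ℂ] H) : tAluthge T (1 / 2) = aluthge T := by
  have h : (1 - 1 / 2 : ℝ) = 1 / 2 := by norm_num
  rw [tAluthge, aluthge, h, absPow, if_neg (by norm_num)]

/-- The bound `½ w(T̃_t) + ¼ (‖T‖^(2t) + ‖T‖^(2-2t))`. -/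
noncomputable def tBound (T : H →L[ℂ] H) (t : ℝ) : ℝ :=
  1 / 2 * numericalRadius (tAluthge T t) + 1 / 4 * (‖T‖ ^ (2 * t) + ‖T‖ ^ (2 - 2 * t))

end Operators

section FiniteDimensional

variable {H K : Type*} [NormedAddCommGroup H] [InnerProductSpace ℂ H]
  [NormedAddCommGroup K] [InnerProductSpace ℂ K]

/-- Unitary similarity of operators on two Hilbert spaces. -/
def UnitarilySimilar (T : H →L[ℂ] H) (S : K →L[ℂ] K) : Prop :=
  ∃ V : H ≃ₗᵢ[ℂ] K, ∀ x, V (T x) = S (V x)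

/-- The direct sum `A ⊕ B` on the orthogonal (`ℓ²`) direct sum of the two spaces. -/
noncomputable def directSum (A : H →L[ℂ] H) (B : K →L[ℂ] K) :
    WithLp 2 (H × K) →L[ℂ] WithLp 2 (H × K) :=
  (WithLp.prodContinuousLinearEquiv 2 ℂ H K).symm.toContinuousLinearMap ∘L
    (A.prodMap B) ∘L (WithLp.prodContinuousLinearEquiv 2 ℂ H K).toContinuousLinearMap

/-- `T` is unitarily similar to `[a] ⊕ B` with `‖B‖ ≤ |a|`. The summand `B` may act on the
zero space. -/
def HasFormOne (T : H →L[ℂ] H) : Prop :=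
  ∃ (m : ℕ) (a : ℂ) (B : EuclideanSpace ℂ (Fin m) →L[ℂ] EuclideanSpace ℂ (Fin m)),
    UnitarilySimilar T (directSum (Matrix.toEuclideanCLM (𝕜 := ℂ) !![a]) B) ∧ ‖B‖ ≤ ‖a‖

/-- `T` is unitarily similar to `[[a, 0], [b, 0]] ⊕ C` with `‖C‖ ≤ (|a|² + |b|²)^(1/2)` and
`w(C̃_t) ≤ |a|`. The summand `C` may act on the zero space. -/
def HasFormTwo (T : H →L[ℂ] H) (t : ℝ) : Prop :=
  ∃ (m : ℕ) (a b : ℂ) (C : EuclideanSpace ℂ (Fin m) →L[ℂ] EuclideanSpace ℂ (Fin m)),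
    UnitarilySimilar T (directSum (Matrix.toEuclideanCLM (𝕜 := ℂ) !![a, 0; b, 0]) C) ∧
    ‖C‖ ≤ Real.sqrt (‖a‖ ^ 2 + ‖b‖ ^ 2) ∧ numericalRadius (tAluthge C t) ≤ ‖a‖

end FiniteDimensional

end NumRadius

/-! Fix `t ∈ [0,1]`, a unit scalar `z` and a unit vector `x`, and put `L = z|T|^t + |T|^(1-t)U*`, `y
= Lx`. The two terms of `y` have inner product `z⟨Tx,x⟩`, so polarization gives `4 Re z⟨Tx,x⟩ ≤
‖y‖²`. Cauchy–Schwarz gives `‖y‖² = ⟨Lx,y⟩ ≤ ‖L*y‖`. Expanding `‖L*y‖²`, the cross term is `2 Re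
z⟨T̃_t y,y⟩` and the two squares are at most `‖T‖^(2t)‖y‖²` and `‖T‖^(2-2t)‖y‖²`; hence `‖L*y‖² ≤
4β‖y‖²` with `β = tBound T t`. Thus `‖y‖² ≤ 4β` and `w(T) ≤ β` (`numericalRadius_le_tBound`). The
minimum over `t` exists because `w(T̃_t)` is a supremum of functions continuous in `t`, hence lower
semicontinuous; this uses strong continuity of `|T|^t` on `[0,1]` (`continuousOn_absPow_apply`).

In finite dimension `w(T)` is attained at some `x`, and equality makes every step above an equality:
the two terms of `y` agree, `L*y = 4βx`, and `|T|y = ‖T‖y`. Applying `|T|^t` and `|T|^(1-t)U*` to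
`L*y = 4βx` yields `Uy - κy ∈ ker T` and `U*y = κ̄y`; the two resulting values of `κ` agree only if
`‖T‖^t = ‖T‖^(1-t)` (`exists_reducing_vector`). So the span of `y` and `Uy` reduces `T`: dimension
one gives form (A), dimension two gives form (B_t).

Conversely, (A) makes `T` normaloid, where the bound at `t = 1/2` is at most `‖T‖`. Under (B_t),
`w(T̃_t) ≤ |a|`, while the `2 × 2` block already has numerical radius at least `(|a| + ‖T‖)/2`. -/

namespace NumRadius

/-! ### Functional calculus, polar factor and Aluthge transform under intertwining maps -/

section Intertwining

variable {H K : Type*} [NormedAddCommGroup H] [InnerProductSpace ℂ H]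
  [NormedAddCommGroup K] [InnerProductSpace ℂ K]

theorem aeval_intertwine {a : H →L[ℂ] H} {b : K →L[ℂ] K} {J : K →L[ℂ] H}
    (h : ∀ k, a (J k) = J (b k)) (p : Polynomial ℝ) (k : K) :
    Polynomial.aeval a p (J k) = J (Polynomial.aeval b p k) := by
  induction p using Polynomial.induction_on' with
  | add p q hp hq => simp [hp, hq]
  | monomial n r =>
    have hpow : ∀ (n : ℕ) (k : K), (a ^ n) (J k) = J ((b ^ n) k) := by
      intro n
      induction n with
      | zero => simp
      | succ n ih => intro k; rw [pow_succ, pow_succ]; simp [h, ih]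
    simp [Polynomial.aeval_monomial, Algebra.algebraMap_eq_smul_one, hpow]

variable [CompleteSpace H]

/-- The spectrum lies in `[-‖a‖, ‖a‖]`. The larger radius `R` is allowed so that one Weierstrass
polynomial can serve two operators. -/
theorem norm_cfc_sub_aeval_le {a : H →L[ℂ] H} (ha : IsSelfAdjoint a) {f : ℝ → ℝ}
    (hf : Continuous f) {p : Polynomial ℝ} {R ε : ℝ} (hR : ‖a‖ ≤ R) (hε : 0 ≤ ε)
    (hp : ∀ x ∈ Set.Icc (-R) R, |p.eval x - f x| < ε) :
    ‖cfc f a - Polynomial.aeval a p‖ ≤ ε := by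
  rcases subsingleton_or_nontrivial H with hH | hH
  · simpa [Subsingleton.elim (cfc f a) (Polynomial.aeval a p)] using hε
  rw [← cfc_polynomial p a, ← cfc_sub f p.eval a (hf.continuousOn) (by fun_prop)]
  refine norm_cfc_le hε fun x hx => ?_
  have hx' : ‖x‖ ≤ ‖a‖ := spectrum.norm_le_norm_of_mem hx
  have := hp x (abs_le.1 (hx'.trans hR))
  rw [Real.norm_eq_abs, abs_sub_comm]
  exact this.le

/-- A closed subspace that contains `ker T` and the range of `|T|` is the whole space. -/
theorem eq_top_of_ker_le_of_range_abs_le (T : H →L[ℂ] H) {D : Submodule ℂ H}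
    (hD : IsClosed (D : Set H)) (hker : ∀ x, T x = 0 → x ∈ D) (habs : ∀ x, CFC.abs T x ∈ D) :
    D = ⊤ := by
  have hle : (LinearMap.ker T.toLinearMap)ᗮ ≤ D := by
    rw [← closure_range_abs]
    refine Submodule.topologicalClosure_minimal _ ?_ hD
    rintro _ ⟨x, rfl⟩
    exact habs x
  have : CompleteSpace (LinearMap.ker T.toLinearMap) :=
    (ContinuousLinearMap.isClosed_ker T).completeSpace_coe
  rw [eq_top_iff, ← Submodule.sup_orthogonal_of_hasOrthogonalProjection
    (K := LinearMap.ker T.toLinearMap)]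
  exact sup_le (fun x hx => hker x hx) hle

theorem eq_of_eqOn_ker_of_eqOn_range_abs {F G : H →L[ℂ] K} (T : H →L[ℂ] H)
    (hker : ∀ x, T x = 0 → F x = G x) (habs : ∀ x, F (CFC.abs T x) = G (CFC.abs T x)) :
    F = G := by
  have htop : LinearMap.ker (F - G).toLinearMap = ⊤ :=
    eq_top_of_ker_le_of_range_abs_le T (ContinuousLinearMap.isClosed_ker (F - G))
      (fun x hx => by simp [hker x hx]) fun x => by simp [habs]
  rw [← sub_eq_zero]
  ext x
  exact LinearMap.mem_ker.1 (htop ▸ Submodule.mem_top (x := x))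

variable [CompleteSpace K]

/-- Polynomials intertwine, and a single polynomial approximates `f` on both spectra. `J` is an
arbitrary bounded map: it will be an embedding of a summand, or the map `ℂ → H` given by an
eigenvector. -/
theorem cfc_intertwine {a : H →L[ℂ] H} {b : K →L[ℂ] K} (ha : IsSelfAdjoint a)
    (hb : IsSelfAdjoint b) {J : K →L[ℂ] H} (h : ∀ k, a (J k) = J (b k)) {f : ℝ → ℝ}
    (hf : Continuous f) (k : K) : cfc f a (J k) = J (cfc f b k) := by
  rw [← sub_eq_zero, ← norm_eq_zero]
  refine le_antisymm (le_of_forall_pos_le_add fun δ hδ => ?_) (norm_nonneg _)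
  set R := max ‖a‖ ‖b‖
  set M : ℝ := ‖J‖ * ‖k‖
  have hM : 0 ≤ M := by positivity
  -- Each of the two approximation errors costs at most `ε * M`; the `+ 1` covers `M = 0`.
  set ε : ℝ := δ / (2 * (M + 1))
  have hε : 0 < ε := by positivity
  obtain ⟨p, hp⟩ := exists_polynomial_near_of_continuousOn (-R) R f hf.continuousOn ε hε
  have h1 := norm_cfc_sub_aeval_le ha hf (le_max_left ‖a‖ ‖b‖) hε.le hp
  have h2 := norm_cfc_sub_aeval_le hb hf (le_max_right ‖a‖ ‖b‖) hε.le hp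
  have e : cfc f a (J k) - J (cfc f b k) =
      (cfc f a - Polynomial.aeval a p) (J k) - J ((cfc f b - Polynomial.aeval b p) k) := by
    simp [aeval_intertwine h]
  rw [e]
  calc _ ≤ ‖(cfc f a - Polynomial.aeval a p) (J k)‖ + ‖J ((cfc f b - Polynomial.aeval b p) k)‖ :=
        norm_sub_le _ _
    _ ≤ ε * (‖J‖ * ‖k‖) + ‖J‖ * (ε * ‖k‖) := by
        gcongr
        · refine (ContinuousLinearMap.le_opNorm _ _).trans ?_
          gcongr
          exact J.le_opNorm k
        · refine (ContinuousLinearMap.le_opNorm _ _).trans ?_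
          gcongr
          refine (ContinuousLinearMap.le_opNorm _ _).trans ?_
          gcongr
    _ = δ * (M / (M + 1)) := by simp only [ε, M]; field_simp; ring
    _ ≤ 0 + δ := by
        rw [zero_add]
        exact mul_le_of_le_one_right hδ.le ((div_le_one (by positivity)).2 (by linarith))

theorem abs_eq_cfc_sqrt (T : H →L[ℂ] H) : CFC.abs T = cfc Real.sqrt (star T * T) := by
  rw [CFC.abs, CFC.sqrt_eq_real_sqrt _ (star_mul_self_nonneg T), cfcₙ_eq_cfc]

theorem abs_intertwine {T : H →L[ℂ] H} {S : K →L[ℂ] K} {J : K →L[ℂ] H}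
    (h : ∀ k, T (J k) = J (S k)) (h' : ∀ k, star T (J k) = J (star S k)) (k : K) :
    CFC.abs T (J k) = J (CFC.abs S k) := by
  rw [abs_eq_cfc_sqrt, abs_eq_cfc_sqrt]
  exact cfc_intertwine (.star_mul_self T) (.star_mul_self S)
    (fun k => by simp [h, h']) Real.continuous_sqrt k

theorem abs_rpow_intertwine {T : H →L[ℂ] H} {S : K →L[ℂ] K} {J : K →L[ℂ] H}
    (h : ∀ k, CFC.abs T (J k) = J (CFC.abs S k)) {s : ℝ} (hs : 0 ≤ s) (k : K) :
    (CFC.abs T ^ s) (J k) = J ((CFC.abs S ^ s) k) := by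
  rw [CFC.rpow_eq_cfc_real (CFC.abs_nonneg T), CFC.rpow_eq_cfc_real (CFC.abs_nonneg S)]
  exact cfc_intertwine (CFC.abs_nonneg T).isSelfAdjoint (CFC.abs_nonneg S).isSelfAdjoint h
    (Real.continuous_rpow_const hs) k

theorem polarFactor_abs (T : H →L[ℂ] H) (x : H) : polarFactor T (CFC.abs T x) = T x :=
  (congrArg (fun A : H →L[ℂ] H => A x) (polarFactor_spec T).2.1).symm

theorem polarFactor_eq_zero_iff {T : H →L[ℂ] H} {x : H} : polarFactor T x = 0 ↔ T x = 0 := by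
  have := congrArg (fun M => x ∈ M) (polarFactor_spec T).2.2
  simpa using this.symm

theorem abs_eq_zero_iff {T : H →L[ℂ] H} {x : H} : CFC.abs T x = 0 ↔ T x = 0 := by
  have := congrArg (fun M => x ∈ M) (ker_abs T)
  simpa using this

theorem abs_star_eq (T : H →L[ℂ] H) : star (CFC.abs T) = CFC.abs T :=
  (CFC.abs_nonneg T).isSelfAdjoint.star_eq

theorem inner_star_left (A : H →L[ℂ] H) (x y : H) : inner ℂ (star A x) y = inner ℂ x (A y) := by
  rw [ContinuousLinearMap.star_eq_adjoint, ContinuousLinearMap.adjoint_inner_left]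

theorem inner_star_right (A : H →L[ℂ] H) (x y : H) : inner ℂ x (star A y) = inner ℂ (A x) y := by
  rw [ContinuousLinearMap.star_eq_adjoint, ContinuousLinearMap.adjoint_inner_right]

theorem norm_polarFactor_of_orthogonal {T : H →L[ℂ] H} {x : H}
    (hx : ∀ y, T y = 0 → inner ℂ y x = 0) : ‖polarFactor T x‖ = ‖x‖ := by
  refine (polarFactor_spec T).1 x ?_
  rw [Submodule.mem_orthogonal]
  intro y hy
  exact hx y (polarFactor_eq_zero_iff.1 hy)

theorem norm_polarFactor_le (T : H →L[ℂ] H) (x : H) : ‖polarFactor T x‖ ≤ ‖x‖ := by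
  have : CompleteSpace (LinearMap.ker T.toLinearMap) :=
    (ContinuousLinearMap.isClosed_ker T).completeSpace_coe
  set N := LinearMap.ker T.toLinearMap
  have hN : ∀ y, y ∈ N ↔ T y = 0 := fun y => Iff.rfl
  have hq : ‖polarFactor T (x - N.starProjection x)‖ = ‖x - N.starProjection x‖ := by
    refine norm_polarFactor_of_orthogonal fun y hy => ?_
    exact N.sub_starProjection_mem_orthogonal x y ((hN y).2 hy)
  have hz : polarFactor T (N.starProjection x) = 0 :=
    polarFactor_eq_zero_iff.2 ((hN _).1 (N.starProjection_apply_mem x))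
  rw [map_sub, hz, sub_zero] at hq
  rw [hq]
  have h2 := N.norm_sq_eq_add_norm_sq_starProjection x
  rw [Submodule.starProjection_orthogonal_val] at h2
  nlinarith [norm_nonneg x, norm_nonneg (x - N.starProjection x), norm_nonneg (N.starProjection x)]

theorem norm_polarFactor_le_one (T : H →L[ℂ] H) : ‖polarFactor T‖ ≤ 1 :=
  ContinuousLinearMap.opNorm_le_bound _ zero_le_one fun x => by
    simpa using norm_polarFactor_le T x

/-- `U*` is a contraction and `⟨U*Ux, x⟩ = ‖Ux‖² = ‖x‖²`, so expanding the square gives `‖U*Ux - x‖²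
≤ 0`. -/
theorem star_polarFactor_mul_self_of_orthogonal {T : H →L[ℂ] H} {x : H}
    (hx : ∀ y, T y = 0 → inner ℂ y x = 0) : star (polarFactor T) (polarFactor T x) = x := by
  set U := polarFactor T
  have h1 : ‖U x‖ = ‖x‖ := norm_polarFactor_of_orthogonal hx
  have h2 : ‖star U (U x)‖ ≤ ‖x‖ := by
    refine (ContinuousLinearMap.le_opNorm _ _).trans ?_
    rw [norm_star, h1]
    exact mul_le_of_le_one_left (norm_nonneg _) (norm_polarFactor_le_one T)
  have h3 : RCLike.re (inner ℂ (star U (U x)) x : ℂ) = ‖x‖ ^ 2 := by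
    rw [inner_star_left, inner_self_eq_norm_sq, h1]
  have h4 := norm_sub_sq (𝕜 := ℂ) (star U (U x)) x
  rw [h3] at h4
  rw [← sub_eq_zero, ← norm_eq_zero, ← sq_eq_zero_iff]
  refine le_antisymm ?_ (sq_nonneg _)
  have := norm_nonneg (star U (U x))
  nlinarith

theorem inner_abs_of_ker {T : H →L[ℂ] H} {x y : H} (hy : T y = 0) :
    inner ℂ y (CFC.abs T x) = 0 := by
  rw [← inner_star_left, abs_star_eq, abs_eq_zero_iff.2 hy, inner_zero_left]

theorem star_polarFactor_polarFactor_abs (T : H →L[ℂ] H) (x : H) :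
    star (polarFactor T) (polarFactor T (CFC.abs T x)) = CFC.abs T x :=
  star_polarFactor_mul_self_of_orthogonal fun _ hy => inner_abs_of_ker hy

variable {T : H →L[ℂ] H} {S : K →L[ℂ] K} {J : K →L[ℂ] H}

/-- It suffices to compare both sides on `ker S`, where they vanish, and on the range of `|S|`,
where `U|S| = S`. -/
theorem polarFactor_intertwine (h : ∀ k, T (J k) = J (S k))
    (h' : ∀ k, star T (J k) = J (star S k)) (k : K) :
    polarFactor T (J k) = J (polarFactor S k) := by
  have : polarFactor T ∘L J = J ∘L polarFactor S := by
    refine eq_of_eqOn_ker_of_eqOn_range_abs S (fun x hx => ?_) (fun x => ?_)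
    · have h1 : T (J x) = 0 := by rw [h, hx, map_zero]
      simp [polarFactor_eq_zero_iff.2 hx, polarFactor_eq_zero_iff.2 h1]
    · simp [← abs_intertwine h h', polarFactor_abs, h]
  exact congrArg (fun A : K →L[ℂ] H => A k) this

theorem absPow_zero (T : H →L[ℂ] H) : absPow T 0 = star (polarFactor T) * polarFactor T := by
  rw [absPow, if_pos rfl]

theorem absPow_of_ne_zero (T : H →L[ℂ] H) {s : ℝ} (hs : s ≠ 0) : absPow T s = CFC.abs T ^ s := by
  rw [absPow, if_neg hs]

theorem absPow_intertwine (h : ∀ k, T (J k) = J (S k))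
    (h' : ∀ k, star T (J k) = J (star S k)) {s : ℝ} (hs : 0 ≤ s) (k : K) :
    absPow T s (J k) = J (absPow S s k) := by
  rcases eq_or_ne s 0 with rfl | h0
  · rw [absPow_zero, absPow_zero]
    have : (star (polarFactor T) * polarFactor T) ∘L J =
        J ∘L (star (polarFactor S) * polarFactor S) := by
      refine eq_of_eqOn_ker_of_eqOn_range_abs S (fun x hx => ?_) (fun x => ?_)
      · have h1 : T (J x) = 0 := by rw [h, hx, map_zero]
        simp [polarFactor_eq_zero_iff.2 hx, polarFactor_eq_zero_iff.2 h1]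
      · simp only [ContinuousLinearMap.comp_apply, mul_apply_eq_comp,
          star_polarFactor_polarFactor_abs, ← abs_intertwine h h']
    exact congrArg (fun A : K →L[ℂ] H => A k) this
  · rw [absPow_of_ne_zero _ h0, absPow_of_ne_zero _ h0]
    exact abs_rpow_intertwine (abs_intertwine h h') hs k

theorem tAluthge_intertwine (h : ∀ k, T (J k) = J (S k))
    (h' : ∀ k, star T (J k) = J (star S k)) {t : ℝ} (ht : t ∈ Set.Icc (0 : ℝ) 1) (k : K) :
    tAluthge T t (J k) = J (tAluthge S t k) := by
  simp only [tAluthge, mul_apply_eq_comp]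
  rw [absPow_intertwine h h' (by linarith [ht.2]), polarFactor_intertwine h h',
    absPow_intertwine h h' ht.1]

end Intertwining

/-! ### Powers of `|T|`: products, norms, eigenvectors, continuity in the exponent -/

section AbsPow

variable {H : Type*} [NormedAddCommGroup H] [InnerProductSpace ℂ H] [CompleteSpace H]
  (T : H →L[ℂ] H)

theorem spectrum_abs_nonneg {x : ℝ} (hx : x ∈ spectrum ℝ (CFC.abs T)) : 0 ≤ x :=
  spectrum_nonneg_of_nonneg (CFC.abs_nonneg T) hx

theorem abs_rpow_add {r s : ℝ} (hr : 0 ≤ r) (hs : 0 ≤ s) :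
    CFC.abs T ^ (r + s) = CFC.abs T ^ r * CFC.abs T ^ s := by
  have h0 := CFC.abs_nonneg T
  rw [CFC.rpow_eq_cfc_real h0, CFC.rpow_eq_cfc_real h0, CFC.rpow_eq_cfc_real h0,
    ← cfc_mul _ _ _ (Real.continuous_rpow_const hr).continuousOn
      (Real.continuous_rpow_const hs).continuousOn]
  exact cfc_congr fun x hx => Real.rpow_add_of_nonneg (spectrum_abs_nonneg T hx) hr hs

theorem star_absPow (s : ℝ) : star (absPow T s) = absPow T s := by
  rcases eq_or_ne s 0 with rfl | h0
  · simp [absPow_zero]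
  · rw [absPow_of_ne_zero T h0]
    exact (CFC.rpow_nonneg (a := CFC.abs T)).isSelfAdjoint.star_eq

theorem absPow_zero_mul_abs : absPow T 0 * CFC.abs T = CFC.abs T := by
  ext x
  rw [absPow_zero]
  exact star_polarFactor_polarFactor_abs T x

theorem abs_mul_absPow_zero : CFC.abs T * absPow T 0 = CFC.abs T := by
  have := congrArg star (absPow_zero_mul_abs T)
  rwa [star_mul, star_absPow, abs_star_eq] at this

theorem absPow_one : absPow T 1 = CFC.abs T := by
  rw [absPow_of_ne_zero T one_ne_zero, CFC.rpow_one _ (CFC.abs_nonneg T)]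

theorem absPow_mul_absPow {r s : ℝ} (hr : 0 ≤ r) (hs : 0 ≤ s) (h : r + s = 1) :
    absPow T r * absPow T s = CFC.abs T := by
  rcases eq_or_ne r 0 with rfl | hr0
  · obtain rfl : s = 1 := by linarith
    rw [absPow_one, absPow_zero_mul_abs]
  rcases eq_or_ne s 0 with rfl | hs0
  · obtain rfl : r = 1 := by linarith
    rw [absPow_one, abs_mul_absPow_zero]
  rw [absPow_of_ne_zero T hr0, absPow_of_ne_zero T hs0, ← abs_rpow_add T hr hs, h,
    CFC.rpow_one _ (CFC.abs_nonneg T)]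

theorem norm_abs_eq : ‖CFC.abs T‖ = ‖T‖ := CFC.norm_abs

theorem norm_absPow_le {s : ℝ} (hs : 0 ≤ s) : ‖absPow T s‖ ≤ ‖T‖ ^ s := by
  rcases eq_or_ne s 0 with rfl | h0
  · rw [absPow_zero, Real.rpow_zero, CStarRing.norm_star_mul_self]
    exact mul_le_one₀ (norm_polarFactor_le_one T) (norm_nonneg _) (norm_polarFactor_le_one T)
  · rw [absPow_of_ne_zero T h0, CFC.norm_rpow _ (lt_of_le_of_ne hs h0.symm) (CFC.abs_nonneg T),
      norm_abs_eq]

theorem norm_absPow_apply_le {s : ℝ} (hs : 0 ≤ s) (x : H) : ‖absPow T s x‖ ≤ ‖T‖ ^ s * ‖x‖ :=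
  (ContinuousLinearMap.le_opNorm _ _).trans (by gcongr; exact norm_absPow_le T hs)

variable {T}

theorem abs_rpow_apply_of_eigen {x : H} {μ s : ℝ} (hx : CFC.abs T x = (μ : ℂ) • x)
    (hs : 0 ≤ s) : (CFC.abs T ^ s) x = ((μ ^ s : ℝ) : ℂ) • x := by
  rw [CFC.rpow_eq_cfc_real (CFC.abs_nonneg T)]
  let J : ℂ →L[ℂ] H := ContinuousLinearMap.toSpanSingleton ℂ x
  have hb : IsSelfAdjoint (algebraMap ℝ (ℂ →L[ℂ] ℂ) μ) := .algebraMap _ (.all μ)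
  have := cfc_intertwine (CFC.abs_nonneg T).isSelfAdjoint hb (J := J)
    (fun k => by
      simp only [J, Algebra.algebraMap_eq_smul_one, ContinuousLinearMap.toSpanSingleton_apply,
        map_smul, hx, smul_smul, smul_apply, one_apply_eq_self, Complex.real_smul, mul_comm])
    (Real.continuous_rpow_const hs) 1
  rw [cfc_algebraMap] at this
  simpa [J, Algebra.algebraMap_eq_smul_one] using this

/-- For `s = 0`, an eigenvector with nonzero eigenvalue lies in the range of `|T|`, where `U*U` is
the identity. -/
theorem absPow_apply_of_eigen {x : H} {μ s : ℝ} (hx : CFC.abs T x = (μ : ℂ) • x) (hμ : μ ≠ 0)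
    (hs : 0 ≤ s) : absPow T s x = ((μ ^ s : ℝ) : ℂ) • x := by
  rcases eq_or_ne s 0 with rfl | h0
  · have hμ' : (μ : ℂ) ≠ 0 := by exact_mod_cast hμ
    have h1 : x = CFC.abs T ((μ : ℂ)⁻¹ • x) := by rw [map_smul, hx, inv_smul_smul₀ hμ']
    have h2 := congrArg (fun A : H →L[ℂ] H => A ((μ : ℂ)⁻¹ • x)) (absPow_zero_mul_abs T)
    simp only [mul_apply_eq_comp] at h2
    rw [← h1] at h2
    simpa using h2
  · rw [absPow_of_ne_zero T h0, abs_rpow_apply_of_eigen hx hs]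

theorem absPow_apply_of_ker {x : H} (hx : T x = 0) {s : ℝ} (hs : 0 ≤ s) : absPow T s x = 0 := by
  rcases eq_or_ne s 0 with rfl | h0
  · simp [absPow_zero, polarFactor_eq_zero_iff.2 hx]
  · have h1 : CFC.abs T x = ((0 : ℝ) : ℂ) • x := by simp [abs_eq_zero_iff.2 hx]
    rw [absPow_of_ne_zero T h0, abs_rpow_apply_of_eigen h1 hs]
    simp [Real.zero_rpow h0]

theorem apply_eq_zero_of_absPow {x : H} {s : ℝ} (hs : s ∈ Set.Icc (0 : ℝ) 1)
    (hx : absPow T s x = 0) : T x = 0 := by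
  rw [← abs_eq_zero_iff, ← absPow_mul_absPow T (r := 1 - s) (s := s) (by linarith [hs.2]) hs.1
    (by ring)]
  simp [hx]

variable (T)

/-- On the compact spectrum `x ^ r` depends uniformly on `r` near any `s > 0`. The endpoint `0` is
excluded: if `0` is in the spectrum, joint continuity of `x ^ r` fails at `(0, 0)`. -/
theorem continuousOn_abs_rpow : ContinuousOn (fun s : ℝ => CFC.abs T ^ s) (Set.Ioi 0) := by
  intro s hs
  refine ContinuousAt.continuousWithinAt ?_
  have h0 := CFC.abs_nonneg T
  simp only [CFC.rpow_eq_cfc_real h0]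
  have hs' : Set.Ioi (0 : ℝ) ∈ nhds s := Ioi_mem_nhds hs
  refine continuousAt_cfc_fun ?_ ?_
  · have : CompactSpace (spectrum ℝ (CFC.abs T)) :=
      isCompact_iff_compactSpace.1 (spectrum.isCompact _)
    rw [tendstoUniformlyOn_iff_tendstoUniformly_comp_coe]
    refine ContinuousOn.tendstoUniformly (f := fun (r : ℝ) (x : spectrum ℝ (CFC.abs T)) =>
      (x : ℝ) ^ r) hs' ?_
    rintro ⟨r, x⟩ ⟨hr, -⟩
    refine ContinuousAt.continuousWithinAt ?_
    exact ContinuousAt.rpow (f := fun p : ℝ × spectrum ℝ (CFC.abs T) => (p.2 : ℝ))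
      (g := fun p => p.1) (by fun_prop) (by fun_prop) (Or.inr hr)
  · filter_upwards [hs'] with r hr
    exact (Real.continuous_rpow_const (le_of_lt hr)).continuousOn

theorem absPow_abs_apply {s : ℝ} (hs : 0 ≤ s) (x : H) :
    absPow T s (CFC.abs T x) = (CFC.abs T ^ (s + 1)) x := by
  have h1 : CFC.abs T ^ (1 : ℝ) = CFC.abs T := CFC.rpow_one _ (CFC.abs_nonneg T)
  rcases eq_or_ne s 0 with rfl | h0
  · rw [zero_add, h1]
    exact congrArg (fun A : H →L[ℂ] H => A x) (absPow_zero_mul_abs T)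
  · rw [absPow_of_ne_zero T h0, abs_rpow_add T hs zero_le_one, h1, mul_apply_eq_comp]

/-- Strong continuity includes the endpoint `0`, thanks to `|T|^0 = U*U`. By the uniform bound on
`‖|T|^s‖`, the vectors with continuous orbit form a closed subspace. It contains `ker T`, where the
orbit is zero, and the range of `|T|`, where `|T|^s |T| = |T|^(s+1)` has exponents at least `1`. -/
theorem continuousOn_absPow_apply (x : H) :
    ContinuousOn (fun s : ℝ => absPow T s x) (Set.Icc 0 1) := by
  let D : Submodule ℂ H :=
    { carrier := {x | ContinuousOn (fun s : ℝ => absPow T s x) (Set.Icc 0 1)}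
      add_mem' := fun {x y} hx hy => by
        simpa only [Set.mem_ofPred_eq, map_add] using ContinuousOn.fun_add hx hy
      zero_mem' := by simpa using continuousOn_const
      smul_mem' := fun c x hx => by
        simpa only [Set.mem_ofPred_eq, map_smul] using ContinuousOn.fun_const_smul hx c }
  have hM : ∀ s ∈ Set.Icc (0 : ℝ) 1, ‖absPow T s‖ ≤ ‖T‖ + 1 := by
    intro s hs
    refine (norm_absPow_le T hs.1).trans ?_
    rcases le_total ‖T‖ 1 with h | h
    · exact (Real.rpow_le_one (norm_nonneg T) h hs.1).trans (by linarith [norm_nonneg T])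
    · calc ‖T‖ ^ s ≤ ‖T‖ ^ (1 : ℝ) := Real.rpow_le_rpow_of_exponent_le h hs.2
        _ ≤ ‖T‖ + 1 := by rw [Real.rpow_one]; linarith
  have hD : IsClosed (D : Set H) := by
    refine isClosed_of_closure_subset fun x hx => ?_
    refine continuousOn_of_uniform_approx_of_continuousOn fun u hu => ?_
    obtain ⟨ε, hε, hεu⟩ := Metric.mem_uniformity_dist.1 hu
    have hN : 0 < ‖T‖ + 1 := by positivity
    obtain ⟨y, hy, hxy⟩ := Metric.mem_closure_iff.1 hx (ε / (‖T‖ + 1)) (by positivity)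
    refine ⟨_, hy, fun s hs => hεu ?_⟩
    rw [dist_eq_norm, ← map_sub]
    calc _ ≤ ‖absPow T s‖ * ‖x - y‖ := ContinuousLinearMap.le_opNorm _ _
      _ ≤ (‖T‖ + 1) * ‖x - y‖ := by gcongr; exact hM s hs
      _ < (‖T‖ + 1) * (ε / (‖T‖ + 1)) := by gcongr; rwa [← dist_eq_norm]
      _ = ε := by field_simp
  have hker : ∀ x, T x = 0 → x ∈ D := fun x hx =>
    ContinuousOn.congr (f := fun _ => (0 : H)) continuousOn_const
      fun s hs => absPow_apply_of_ker hx hs.1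
  have habs : ∀ x, CFC.abs T x ∈ D := by
    intro x
    refine ContinuousOn.congr (f := fun s : ℝ => (CFC.abs T ^ (s + 1)) x) ?_
      fun s hs => absPow_abs_apply T hs.1 x
    refine ContinuousOn.clm_apply ?_ continuousOn_const
    exact (continuousOn_abs_rpow T).comp (by fun_prop) fun s hs => by
      simp only [Set.mem_Ioi]; linarith [hs.1]
  have : x ∈ D := eq_top_of_ker_le_of_range_abs_le T hD hker habs ▸ Submodule.mem_top
  exact this

theorem inner_tAluthge (t : ℝ) (x : H) : inner ℂ x (tAluthge T t x) =
    inner ℂ (absPow T t x) (polarFactor T (absPow T (1 - t) x)) := by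
  rw [tAluthge, mul_apply_eq_comp, mul_apply_eq_comp, ← inner_star_left, star_absPow]

theorem continuousOn_inner_tAluthge (x : H) :
    ContinuousOn (fun t : ℝ => inner ℂ x (tAluthge T t x)) (Set.Icc 0 1) := by
  simp only [inner_tAluthge]
  refine ContinuousOn.inner (continuousOn_absPow_apply T x) ?_
  refine (polarFactor T).continuous.comp_continuousOn ?_
  exact (continuousOn_absPow_apply T x).comp (by fun_prop)
    fun t ht => ⟨by linarith [ht.2], by linarith [ht.1]⟩

end AbsPow

/-! ### Elementary properties of the numerical radius -/

section NumericalRadius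

variable {H : Type*} [NormedAddCommGroup H] [InnerProductSpace ℂ H]

theorem norm_inner_le_numericalRadius (T : H →L[ℂ] H) (x : H) :
    ‖(inner ℂ x (T x) : ℂ)‖ ≤ numericalRadius T * ‖x‖ ^ 2 := by
  rcases eq_or_ne x 0 with rfl | hx
  · simp
  have hn : 0 < ‖x‖ := norm_pos_iff.2 hx
  set y : H := ((‖x‖⁻¹ : ℝ) : ℂ) • x
  have hy : ‖y‖ = 1 := by
    simp only [y, norm_smul, Complex.norm_real, norm_inv, norm_norm]
    field_simp
  have h1 : ‖(inner ℂ y (T y) : ℂ)‖ ≤ numericalRadius T :=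
    le_csSup (bddAbove_numericalRange T) ⟨_, ⟨y, hy, rfl⟩, rfl⟩
  have h2 : ‖(inner ℂ y (T y) : ℂ)‖ = ‖x‖⁻¹ ^ 2 * ‖(inner ℂ x (T x) : ℂ)‖ := by
    simp only [y, map_smul, inner_smul_left, inner_smul_right, norm_mul, Complex.norm_conj,
      Complex.norm_real, norm_inv, norm_norm]
    ring
  rw [h2, inv_pow, inv_mul_le_iff₀ (by positivity)] at h1
  linarith

theorem numericalRadius_nonneg (T : H →L[ℂ] H) : 0 ≤ numericalRadius T :=
  Real.sSup_nonneg (by rintro _ ⟨z, -, rfl⟩; exact norm_nonneg z)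

theorem numericalRadius_zero : numericalRadius (0 : H →L[ℂ] H) = 0 := by
  refine le_antisymm ?_ (numericalRadius_nonneg _)
  refine Real.sSup_le ?_ le_rfl
  rintro _ ⟨z, ⟨x, -, rfl⟩, rfl⟩
  simp

theorem numericalRadius_le_of_forall {T : H →L[ℂ] H} {M : ℝ} (hM : 0 ≤ M)
    (h : ∀ x : H, ‖x‖ = 1 → ‖(inner ℂ x (T x) : ℂ)‖ ≤ M) : numericalRadius T ≤ M := by
  refine Real.sSup_le ?_ hM
  rintro _ ⟨z, ⟨x, hx, rfl⟩, rfl⟩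
  exact h x hx

theorem numericalRadius_le_norm (T : H →L[ℂ] H) : numericalRadius T ≤ ‖T‖ :=
  numericalRadius_le_of_forall (norm_nonneg T) fun x hx => by
    refine (norm_inner_le_norm _ _).trans ?_
    rw [hx, one_mul]
    exact T.le_opNorm_of_le hx.le |>.trans (by simp)

/-- The power bound `‖T‖ ≤ 2 w(T)`. -/
theorem norm_le_two_mul_numericalRadius (T : H →L[ℂ] H) : ‖T‖ ≤ 2 * numericalRadius T := by
  set w := numericalRadius T
  have hw : 0 ≤ w := numericalRadius_nonneg T
  -- Polarization writes `4⟨y, Tx⟩` through the quadratic form at `x ± y` and `x ± iy`; the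
  -- parallelogram law sums the four squared norms to `4(‖x‖² + ‖y‖²)`.
  have key : ∀ x y : H, 4 * ‖(inner ℂ y (T x) : ℂ)‖ ≤ 4 * w * (‖x‖ ^ 2 + ‖y‖ ^ 2) := by
    intro x y
    have e : (4 : ℂ) * inner ℂ y (T x) =
        inner ℂ (x + y) (T (x + y)) - inner ℂ (x - y) (T (x - y))
        + Complex.I * inner ℂ (x + Complex.I • y) (T (x + Complex.I • y))
        - Complex.I * inner ℂ (x - Complex.I • y) (T (x - Complex.I • y)) := by
      simp only [map_add, map_sub, map_smul, inner_add_left, inner_add_right, inner_sub_left,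
        inner_sub_right, inner_smul_left, inner_smul_right, Complex.conj_I]
      linear_combination (2 * inner ℂ y (T x) - 2 * inner ℂ x (T y)) * Complex.I_mul_I
    have h1 := norm_inner_le_numericalRadius T (x + y)
    have h2 := norm_inner_le_numericalRadius T (x - y)
    have h3 := norm_inner_le_numericalRadius T (x + Complex.I • y)
    have h4 := norm_inner_le_numericalRadius T (x - Complex.I • y)
    have p1 := parallelogram_law_with_norm ℂ x y
    have p2 := parallelogram_law_with_norm ℂ x (Complex.I • y)
    rw [norm_smul, Complex.norm_I, one_mul] at p2
    have hn : 4 * ‖(inner ℂ y (T x) : ℂ)‖ = ‖(4 : ℂ) * inner ℂ y (T x)‖ := by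
      rw [norm_mul, Complex.norm_ofNat]
    rw [hn, e]
    refine (norm_sub_le _ _).trans ((add_le_add_left (norm_add_le _ _) _).trans ?_)
    rw [norm_mul, norm_mul, Complex.norm_I, one_mul, one_mul]
    have := norm_sub_le (inner ℂ (x + y) (T (x + y)) : ℂ) (inner ℂ (x - y) (T (x - y)))
    nlinarith
  refine ContinuousLinearMap.opNorm_le_of_unit_norm (𝕜 := ℂ) (by positivity) fun x hx => ?_
  rcases eq_or_ne (T x) 0 with h0 | h0
  · simp [h0]; exact hw
  have hn : 0 < ‖T x‖ := norm_pos_iff.2 h0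
  have := key x (((‖T x‖⁻¹ : ℝ) : ℂ) • T x)
  rw [inner_smul_left, inner_self_eq_norm_sq_to_K, norm_smul, hx] at this
  simp only [norm_mul, Complex.norm_conj, Complex.norm_real, norm_inv, norm_norm] at this
  rw [inv_mul_cancel₀ hn.ne'] at this
  simp only [Complex.coe_algebraMap, norm_pow, Complex.norm_real, norm_norm] at this
  have e2 : ‖T x‖⁻¹ * ‖T x‖ ^ 2 = ‖T x‖ := by field_simp
  rw [e2] at this
  linarith

/-- A supremum of continuous functions is lower semicontinuous. Nontriviality of `H` makes the set
of unit vectors nonempty. -/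
theorem lowerSemicontinuousOn_numericalRadius {X : Type*} [TopologicalSpace X] [Nontrivial H]
    {A : X → H →L[ℂ] H} {s : Set X} (hA : ∀ x, ContinuousOn (fun t => inner ℂ x (A t x)) s) :
    LowerSemicontinuousOn (fun t => numericalRadius (A t)) s := by
  intro t ht r hr
  obtain ⟨x, hx⟩ := exists_norm_eq H zero_le_one
  obtain ⟨_, ⟨z, ⟨y, hy, rfl⟩, rfl⟩, hlt⟩ := exists_lt_of_lt_csSup
    (s := (fun z : ℂ => ‖z‖) '' numericalRange (A t)) ⟨_, _, ⟨x, hx, rfl⟩, rfl⟩ hr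
  have h := ((hA y).norm t ht).eventually (lt_mem_nhds hlt)
  filter_upwards [h] with t' ht'
  refine ht'.trans_le ?_
  simpa [hy] using norm_inner_le_numericalRadius (A t') y

end NumericalRadius

/-! ### Existence of the minimum over `t` -/

section Bound

variable {H : Type*} [NormedAddCommGroup H] [InnerProductSpace ℂ H] [CompleteSpace H]
  (T : H →L[ℂ] H)

theorem tBound_half : tBound T (1 / 2) = 1 / 2 * numericalRadius (aluthge T) + 1 / 2 * ‖T‖ := by
  rw [tBound, tAluthge_half]
  norm_num
  ring

theorem tBound_nonneg (t : ℝ) : 0 ≤ tBound T t := by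
  have := numericalRadius_nonneg (tAluthge T t)
  unfold tBound
  positivity

theorem half_mem_Icc : (1 / 2 : ℝ) ∈ Set.Icc (0 : ℝ) 1 := by constructor <;> norm_num

theorem tBound_zero_half : tBound (0 : H →L[ℂ] H) (1 / 2) = 0 := by
  have h : CFC.abs (0 : H →L[ℂ] H) ^ (1 / 2 : ℝ) = 0 := by
    rw [CFC.abs_zero]
    exact CFC.zero_rpow (by norm_num)
  rw [tBound_half, aluthge, h, zero_mul, zero_mul, numericalRadius_zero]
  simp

theorem exists_isLeast_tBound : ∃ m, IsLeast (tBound T '' Set.Icc 0 1) m := by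
  -- For `T = 0` the convention `0 ^ 0 = 1` makes the norm term discontinuous at the endpoints, but
  -- the bound vanishes at `t = 1/2`.
  rcases eq_or_ne T 0 with rfl | hT
  · refine ⟨0, ⟨1 / 2, half_mem_Icc, tBound_zero_half⟩, ?_⟩
    rintro _ ⟨t, -, rfl⟩
    exact tBound_nonneg _ t
  have : Nontrivial H := by
    by_contra h
    rw [not_nontrivial_iff_subsingleton] at h
    exact hT (Subsingleton.elim _ _)
  have hn : ‖T‖ ≠ 0 := norm_ne_zero_iff.2 hT
  have h1 : LowerSemicontinuousOn (tBound T) (Set.Icc 0 1) := by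
    refine LowerSemicontinuousOn.add ?_ ((Continuous.lowerSemicontinuous ?_).lowerSemicontinuousOn _)
    · exact Continuous.comp_lowerSemicontinuousOn (g := fun r : ℝ => 1 / 2 * r) (by fun_prop)
        (lowerSemicontinuousOn_numericalRadius (continuousOn_inner_tAluthge T))
        (fun a b hab => by simp only; linarith)
    · exact continuous_const.mul (((continuous_const.rpow (by fun_prop) fun _ => Or.inl hn)).add
        (continuous_const.rpow (by fun_prop) fun _ => Or.inl hn))
  obtain ⟨t, ht, hmin⟩ := h1.exists_isMinOn ⟨1 / 2, half_mem_Icc⟩ isCompact_Icc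
  refine ⟨tBound T t, ⟨t, ht, rfl⟩, ?_⟩
  rintro _ ⟨s, hs, rfl⟩
  exact hmin hs

end Bound

/-! ### The upper bound for `w(T)` -/

section Inequality

variable {H : Type*} [NormedAddCommGroup H] [InnerProductSpace ℂ H]

theorem re_mul_inner_le (A : H →L[ℂ] H) {z : ℂ} (hz : ‖z‖ = 1) (y : H) :
    (z * inner ℂ y (A y)).re ≤ numericalRadius A * ‖y‖ ^ 2 := by
  refine (Complex.re_le_norm _).trans ?_
  rw [norm_mul, hz, one_mul]
  exact norm_inner_le_numericalRadius _ y

variable [CompleteSpace H] (T : H →L[ℂ] H)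

/-- The adjoint of `z |T|^t + |T|^(1-t) U*`. -/
noncomputable def polarizer (t : ℝ) (z : ℂ) : H →L[ℂ] H :=
  star z • absPow T t + polarFactor T * absPow T (1 - t)

theorem polarizer_apply (t : ℝ) (z : ℂ) (y : H) : polarizer T t z y =
    star z • absPow T t y + polarFactor T (absPow T (1 - t) y) := by
  simp [polarizer]

/-- This is where the Aluthge transform enters: it is the cross term of the expanded square. -/
theorem norm_polarizer_sq (t : ℝ) {z : ℂ} (hz : ‖z‖ = 1) (y : H) :
    ‖polarizer T t z y‖ ^ 2 = ‖absPow T t y‖ ^ 2 + 2 * (z * inner ℂ y (tAluthge T t y)).re +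
      ‖polarFactor T (absPow T (1 - t) y)‖ ^ 2 := by
  rw [polarizer_apply, norm_add_sq (𝕜 := ℂ), norm_smul, norm_star, hz, one_mul, inner_smul_left,
    inner_tAluthge]
  simp

theorem norm_absPow_sq_le {t : ℝ} (ht : 0 ≤ t) (y : H) :
    ‖absPow T t y‖ ^ 2 ≤ ‖T‖ ^ (2 * t) * ‖y‖ ^ 2 := by
  have h := norm_absPow_apply_le T ht y
  calc ‖absPow T t y‖ ^ 2 ≤ (‖T‖ ^ t * ‖y‖) ^ 2 := by gcongr
    _ = ‖T‖ ^ (2 * t) * ‖y‖ ^ 2 := by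
      rw [mul_pow, ← Real.rpow_mul_natCast (norm_nonneg T)]
      congr 2
      push_cast
      ring

theorem norm_polarFactor_absPow_sq_le {t : ℝ} (ht : t ≤ 1) (y : H) :
    ‖polarFactor T (absPow T (1 - t) y)‖ ^ 2 ≤ ‖T‖ ^ (2 - 2 * t) * ‖y‖ ^ 2 := by
  have h := norm_absPow_sq_le T (sub_nonneg.2 ht) y
  rw [show 2 * (1 - t) = 2 - 2 * t by ring] at h
  refine le_trans ?_ h
  gcongr
  exact norm_polarFactor_le T _

theorem norm_polarizer_sq_le {t : ℝ} (ht : t ∈ Set.Icc (0 : ℝ) 1) {z : ℂ} (hz : ‖z‖ = 1) (y : H) :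
    ‖polarizer T t z y‖ ^ 2 ≤ 4 * tBound T t * ‖y‖ ^ 2 := by
  have h1 := norm_absPow_sq_le T ht.1 y
  have h2 := norm_polarFactor_absPow_sq_le T ht.2 y
  have h3 := re_mul_inner_le (tAluthge T t) hz y
  rw [norm_polarizer_sq T t hz, tBound]
  linarith

/-- The vector `(z |T|^t + |T|^(1-t) U*) x` splits as the sum of its two terms. -/
theorem inner_polarizer (t : ℝ) (z : ℂ) (x y : H) : inner ℂ (polarizer T t z y) x =
    inner ℂ y (z • absPow T t x + absPow T (1 - t) (star (polarFactor T) x)) := by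
  rw [polarizer_apply, inner_add_left, inner_add_right, inner_smul_left, inner_smul_right,
    ← inner_star_left, ← inner_star_left, star_absPow, star_absPow, inner_star_right]
  simp

theorem inner_terms {t : ℝ} (ht : t ∈ Set.Icc (0 : ℝ) 1) (z : ℂ) (x : H) :
    inner ℂ (absPow T (1 - t) (star (polarFactor T) x)) (z • absPow T t x) =
      z * inner ℂ x (T x) := by
  rw [inner_smul_right, ← star_absPow, inner_star_left, inner_star_left,
    ← mul_apply_eq_comp (absPow T (1 - t)),
    absPow_mul_absPow T (by linarith [ht.2]) ht.1 (by ring), polarFactor_abs]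

theorem four_mul_re_inner {t : ℝ} (ht : t ∈ Set.Icc (0 : ℝ) 1) (z : ℂ) (x : H) :
    4 * (z * inner ℂ x (T x)).re =
      ‖z • absPow T t x + absPow T (1 - t) (star (polarFactor T) x)‖ ^ 2 -
      ‖z • absPow T t x - absPow T (1 - t) (star (polarFactor T) x)‖ ^ 2 := by
  rw [norm_add_sq (𝕜 := ℂ), norm_sub_sq (𝕜 := ℂ), ← inner_terms T ht, inner_re_symm]
  simp only [RCLike.re_to_complex]
  ring

/-- With `y = Lx`, moving `L` across the inner product gives `‖y‖² = ⟨L*y, x⟩` up to conjugation;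
then Cauchy–Schwarz. -/
theorem norm_sq_le_norm_polarizer {t : ℝ} {z : ℂ} {x : H} (hx : ‖x‖ = 1) {y : H}
    (hy : y = z • absPow T t x + absPow T (1 - t) (star (polarFactor T) x)) :
    ‖y‖ ^ 2 ≤ ‖polarizer T t z y‖ := by
  have h := norm_inner_le_norm (𝕜 := ℂ) (polarizer T t z y) x
  rw [inner_polarizer, ← hy, inner_self_eq_norm_sq_to_K, hx, mul_one] at h
  simpa using h

theorem norm_sq_le_four_mul_tBound {t : ℝ} (ht : t ∈ Set.Icc (0 : ℝ) 1) {z : ℂ} (hz : ‖z‖ = 1)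
    {x : H} (hx : ‖x‖ = 1) {y : H}
    (hy : y = z • absPow T t x + absPow T (1 - t) (star (polarFactor T) x)) :
    ‖y‖ ^ 2 ≤ 4 * tBound T t := by
  have h1 := norm_sq_le_norm_polarizer T hx hy
  have h2 := norm_polarizer_sq_le T ht hz y
  rcases (sq_nonneg ‖y‖).eq_or_lt with h0 | h0
  · rw [← h0]
    linarith [tBound_nonneg T t]
  · have h3 : ‖y‖ ^ 2 * ‖y‖ ^ 2 ≤ 4 * tBound T t * ‖y‖ ^ 2 := by
      refine le_trans ?_ h2
      rw [← sq]
      gcongr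
    exact le_of_mul_le_mul_right h3 h0

theorem exists_norm_one_mul_eq_norm (a : ℂ) : ∃ z : ℂ, ‖z‖ = 1 ∧ z * a = ‖a‖ := by
  rcases eq_or_ne a 0 with rfl | ha
  · exact ⟨1, by simp⟩
  · have hn : ‖a‖ ≠ 0 := norm_ne_zero_iff.2 ha
    refine ⟨‖a‖ / a, by simp [hn], by field_simp⟩

theorem numericalRadius_le_tBound {t : ℝ} (ht : t ∈ Set.Icc (0 : ℝ) 1) :
    numericalRadius T ≤ tBound T t := by
  refine numericalRadius_le_of_forall (tBound_nonneg T t) fun x hx => ?_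
  obtain ⟨z, hz, hza⟩ := exists_norm_one_mul_eq_norm (inner ℂ x (T x))
  have h1 := four_mul_re_inner T ht z x
  have h2 := norm_sq_le_four_mul_tBound T ht hz hx rfl
  rw [hza, Complex.ofReal_re] at h1
  nlinarith [sq_nonneg ‖z • absPow T t x - absPow T (1 - t) (star (polarFactor T) x)‖]

end Inequality

/-! ### Vectors at which the norm is attained -/

section NormAttaining

variable {H : Type*} [NormedAddCommGroup H] [InnerProductSpace ℂ H] [CompleteSpace H]
  {T : H →L[ℂ] H}

theorem norm_abs_rpow_le {s : ℝ} (hs : 0 ≤ s) : ‖CFC.abs T ^ s‖ ≤ ‖T‖ ^ s := by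
  rcases eq_or_ne s 0 with rfl | h0
  · rw [CFC.rpow_zero _ (CFC.abs_nonneg T), Real.rpow_zero]
    exact ContinuousLinearMap.norm_id_le
  · rw [CFC.norm_rpow _ (lt_of_le_of_ne hs h0.symm) (CFC.abs_nonneg T), norm_abs_eq]

/-- With `c = ‖T‖`, attainment forces `|T|²y = c²y`. Then `g = |T|y - cy` satisfies `|T|g = -cg`,
which positivity of `|T|` rules out unless `g = 0`; the case `c = 0` is immediate. -/
theorem abs_eq_smul_of_norm_eq {y : H} (hy : ‖T‖ * ‖y‖ ≤ ‖T y‖) :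
    CFC.abs T y = (‖T‖ : ℂ) • y := by
  set P := CFC.abs T
  set c := ‖T‖ with hc
  have hPle : ∀ x, ‖P x‖ ≤ c * ‖x‖ := fun x => by
    rw [hc, ← norm_abs_eq T]
    exact P.le_opNorm x
  have hsa : star P = P := abs_star_eq T
  have hPy : ‖P y‖ = c * ‖y‖ := le_antisymm (hPle y) (hy.trans_eq (norm_abs_apply T y).symm)
  have hc0 : 0 ≤ c := norm_nonneg T
  have h1 : P (P y) = ((c ^ 2 : ℝ) : ℂ) • y := by
    rw [← sub_eq_zero, ← norm_eq_zero, ← sq_eq_zero_iff]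
    refine le_antisymm ?_ (sq_nonneg _)
    have hle := hPle (P y)
    rw [norm_sub_sq (𝕜 := ℂ), inner_smul_right, ← hsa, inner_star_left, hsa,
      inner_self_eq_norm_sq_to_K, norm_smul, Complex.norm_real, Real.norm_of_nonneg (by positivity)]
    have e : RCLike.re (((c ^ 2 : ℝ) : ℂ) * (((‖P y‖ : ℝ) : ℂ)) ^ 2) = c ^ 2 * ‖P y‖ ^ 2 := by
      rw [← Complex.ofReal_pow, ← Complex.ofReal_mul]
      simp only [RCLike.re_to_complex, Complex.ofReal_re]
    simp only [Complex.coe_algebraMap] at e ⊢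
    rw [e]
    rw [hPy] at hle ⊢
    have : ‖P (P y)‖ ^ 2 ≤ (c * (c * ‖y‖)) ^ 2 := by gcongr
    nlinarith
  set g := P y - (c : ℂ) • y with hg
  have hPg : P g = (-(c : ℂ)) • g := by
    rw [hg, map_sub, map_smul, h1, smul_sub, smul_smul]
    push_cast
    rw [neg_smul, neg_mul, neg_smul]
    rw [sq]
    abel
  have hpos : 0 ≤ RCLike.re (inner ℂ (P g) g : ℂ) :=
    ((ContinuousLinearMap.nonneg_iff_isPositive _).1 (CFC.abs_nonneg T)).inner_nonneg_left g |>.1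
  rw [← sub_eq_zero]
  change g = 0
  rcases hc0.eq_or_lt with h0 | h0
  · have : P y = 0 := by rw [← norm_eq_zero, hPy, ← h0, zero_mul]
    rw [hg, this, ← h0]
    simp
  · rw [hPg, inner_smul_left, inner_self_eq_norm_sq_to_K] at hpos
    have e : RCLike.re ((starRingEnd ℂ) (-(c : ℂ)) * (((‖g‖ : ℝ) : ℂ)) ^ 2) = -(c * ‖g‖ ^ 2) := by
      rw [← Complex.ofReal_neg, Complex.conj_ofReal, ← Complex.ofReal_pow, ← Complex.ofReal_mul]
      simp only [RCLike.re_to_complex, Complex.ofReal_re]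
      ring
    simp only [Complex.coe_algebraMap] at e hpos
    rw [e] at hpos
    have h2 : c * ‖g‖ ^ 2 = 0 := le_antisymm (by linarith) (by positivity)
    rcases mul_eq_zero.1 h2 with h3 | h3
    · exact absurd h3 h0.ne'
    · exact norm_eq_zero.1 (sq_eq_zero_iff.1 h3)

/-- Since `2s - 1 ≥ 0`, one can write `‖|T|^s y‖² = ⟨|T|y, |T|^(2s-1)y⟩ ≤ ‖Ty‖ ‖T‖^(2s-1) ‖y‖`, and
the common factor cancels. -/
theorem norm_eq_of_norm_absPow {s : ℝ} (hs : 1 / 2 ≤ s) (hT : T ≠ 0) {y : H}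
    (hy : ‖T‖ ^ (2 * s) * ‖y‖ ^ 2 ≤ ‖absPow T s y‖ ^ 2) : ‖T‖ * ‖y‖ ≤ ‖T y‖ := by
  rcases eq_or_ne y 0 with rfl | hy0
  · simp
  have hc : 0 < ‖T‖ := norm_pos_iff.2 hT
  have hy1 : 0 < ‖y‖ := norm_pos_iff.2 hy0
  have hs0 : s ≠ 0 := by linarith
  have h1 : ‖absPow T s y‖ ^ 2 ≤ ‖T y‖ * (‖T‖ ^ (2 * s - 1) * ‖y‖) := by
    have e : (inner ℂ (absPow T s y) (absPow T s y) : ℂ) =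
        inner ℂ (CFC.abs T y) ((CFC.abs T ^ (2 * s - 1)) y) := by
      have h1 : CFC.abs T ^ (1 : ℝ) = CFC.abs T := CFC.rpow_one _ (CFC.abs_nonneg T)
      have hm : absPow T s * absPow T s = CFC.abs T ^ (2 * s - 1) * CFC.abs T := by
        nth_rewrite 2 [← h1]
        rw [absPow_of_ne_zero T hs0, ← abs_rpow_add T (by linarith) (by linarith),
          ← abs_rpow_add T (by linarith) zero_le_one]
        congr 1
        ring
      rw [← inner_star_left, star_absPow, ← mul_apply_eq_comp, hm, mul_apply_eq_comp,
        ← inner_star_right, (CFC.rpow_nonneg (a := CFC.abs T)).isSelfAdjoint.star_eq]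
    have h2 := norm_inner_le_norm (𝕜 := ℂ) (CFC.abs T y) ((CFC.abs T ^ (2 * s - 1)) y)
    rw [← e, inner_self_eq_norm_sq_to_K, norm_abs_apply] at h2
    simp only [Complex.coe_algebraMap, norm_pow, Complex.norm_real, norm_norm] at h2
    refine h2.trans ?_
    gcongr
    exact ContinuousLinearMap.le_of_opNorm_le _ (norm_abs_rpow_le (by linarith)) y
  have h2 := hy.trans h1
  have h3 : ‖T‖ ^ (2 * s) = ‖T‖ ^ (2 * s - 1) * ‖T‖ := by
    rw [← Real.rpow_add_one hc.ne']
    congr 1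
    ring
  have h4 : 0 < ‖T‖ ^ (2 * s - 1) * ‖y‖ := by positivity
  refine le_of_mul_le_mul_right ?_ h4
  rw [h3] at h2
  linarith

end NormAttaining

/-! ### Analysis of the equality case -/

section Equality

variable {H : Type*} [NormedAddCommGroup H] [InnerProductSpace ℂ H] [CompleteSpace H]
  {T : H →L[ℂ] H}

theorem tBound_pos (hT : T ≠ 0) {t : ℝ} (ht : t ∈ Set.Icc (0 : ℝ) 1) : 0 < tBound T t := by
  have h1 := numericalRadius_le_tBound T ht
  have h2 := norm_le_two_mul_numericalRadius T
  have h3 : 0 < ‖T‖ := norm_pos_iff.2 hT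
  linarith

/-- Equality in the bound of the numerical radius: the extremal vector. -/
theorem exists_extremal_vector (hT : T ≠ 0) {t : ℝ} (ht : t ∈ Set.Icc (0 : ℝ) 1) {z : ℂ}
    (hz : ‖z‖ = 1) {x : H} (hx : ‖x‖ = 1) (heq : (z * inner ℂ x (T x)).re = tBound T t) :
    ∃ y : H, y ≠ 0 ∧ CFC.abs T y = (‖T‖ : ℂ) • y ∧ y = (2 * z) • absPow T t x ∧
      y = (2 : ℂ) • absPow T (1 - t) (star (polarFactor T) x) ∧
      polarizer T t z y = ((4 * tBound T t : ℝ) : ℂ) • x := by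
  set u := z • absPow T t x with hu
  set v := absPow T (1 - t) (star (polarFactor T) x) with hv
  have hβ := tBound_pos hT ht
  set β := tBound T t with hβd
  obtain ⟨y, hy⟩ : ∃ y, y = u + v := ⟨_, rfl⟩
  have h1 := four_mul_re_inner T ht z x
  rw [← hu, ← hv, ← hy, heq] at h1
  have h2 : ‖y‖ ^ 2 ≤ 4 * β := norm_sq_le_four_mul_tBound T ht hz hx hy
  -- Here `4β = ‖y‖² - ‖u - v‖²` while `‖y‖² ≤ 4β`, so the two terms coincide and `‖y‖² = 4β`.
  have h3 : ‖u - v‖ ^ 2 = 0 := le_antisymm (by linarith) (sq_nonneg _)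
  have huv : u = v := sub_eq_zero.1 (norm_eq_zero.1 (sq_eq_zero_iff.1 h3))
  have h4 : ‖y‖ ^ 2 = 4 * β := by linarith
  have h5 := norm_sq_le_norm_polarizer T hx hy
  have h6 := norm_polarizer_sq_le T ht hz y
  rw [← hβd] at h6
  set a := polarizer T t z y with ha
  have h7 : ‖a‖ = 4 * β := by
    refine le_antisymm ?_ (h4 ▸ h5)
    rw [h4] at h6
    nlinarith [norm_nonneg a]
  have hax : a = ((4 * β : ℝ) : ℂ) • x := by
    rw [← sub_eq_zero, ← norm_eq_zero, ← sq_eq_zero_iff, norm_sub_sq (𝕜 := ℂ), inner_smul_right,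
      ha, inner_polarizer, ← hu, ← hv, ← hy, ← ha, inner_self_eq_norm_sq_to_K, norm_smul, hx, h7]
    rw [← RCLike.ofReal_pow, h4, Complex.norm_real, Real.norm_of_nonneg (by positivity)]
    simp only [Complex.coe_algebraMap, ← Complex.ofReal_mul, RCLike.re_to_complex,
      Complex.ofReal_re]
    ring
  have h8 : ‖a‖ ^ 2 = 4 * β * ‖y‖ ^ 2 := by rw [h7, h4]; ring
  rw [ha, norm_polarizer_sq T t hz, hβd, tBound] at h8
  have k1 := norm_absPow_sq_le T ht.1 y
  have k2 := norm_polarFactor_absPow_sq_le T ht.2 y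
  have k3 := re_mul_inner_le (tAluthge T t) hz y
  -- The three estimates `k1`, `k2`, `k3` add up to an equality, so each is sharp. Whichever of `t`
  -- and `1 - t` is at least `1/2` gives norm attainment.
  have hatt : ‖T‖ * ‖y‖ ≤ ‖T y‖ := by
    rcases le_total (1 / 2) t with h | h
    · exact norm_eq_of_norm_absPow h hT (by linarith)
    · refine norm_eq_of_norm_absPow (s := 1 - t) (by linarith) hT ?_
      have k4 : ‖polarFactor T (absPow T (1 - t) y)‖ ^ 2 ≤ ‖absPow T (1 - t) y‖ ^ 2 := by
        gcongr
        exact norm_polarFactor_le T _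
      rw [show 2 * (1 - t) = 2 - 2 * t by ring]
      linarith
  refine ⟨y, ?_, abs_eq_smul_of_norm_eq hatt, ?_, ?_, hax⟩
  · rintro rfl
    simp at h4
    linarith
  · rw [hy, ← huv, mul_smul, ← hu, two_smul]
  · rw [hy, huv, two_smul]

theorem inner_eq_zero_of_ker_of_abs {y k : H} {c : ℝ} (hc : c ≠ 0)
    (hy : CFC.abs T y = (c : ℂ) • y) (hk : T k = 0) : inner ℂ k y = 0 := by
  have h := inner_abs_of_ker (x := y) hk
  rw [hy, inner_smul_right] at h
  exact (mul_eq_zero.1 h).resolve_left (by exact_mod_cast hc)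

/-- Equality in the bound forces a reducing subspace of dimension at most two. -/
theorem exists_reducing_vector (hT : T ≠ 0) {t : ℝ} (ht : t ∈ Set.Icc (0 : ℝ) 1) {z : ℂ}
    (hz : ‖z‖ = 1) {x : H} (hx : ‖x‖ = 1) (heq : (z * inner ℂ x (T x)).re = tBound T t) :
    (t = 1 / 2 ∨ ‖T‖ = 1) ∧ ∃ (y : H) (κ : ℂ), ‖y‖ = 1 ∧ CFC.abs T y = (‖T‖ : ℂ) • y ∧
      T (polarFactor T y - κ • y) = 0 ∧ star (polarFactor T) y = star κ • y ∧
      ‖T‖ * ‖κ‖ = numericalRadius (tAluthge T t) := by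
  obtain ⟨y, hy0, hPy, hy1, hy2, hpol⟩ := exists_extremal_vector hT ht hz hx heq
  have hc : 0 < ‖T‖ := norm_pos_iff.2 hT
  have ht' : 0 ≤ 1 - t := by linarith [ht.2]
  have hzz : z * star z = 1 := by
    rw [Complex.star_def, Complex.mul_conj, Complex.normSq_eq_norm_sq, hz]; simp
  have hz0 : z ≠ 0 := left_ne_zero_of_mul_eq_one hzz
  have hzs : star z ≠ 0 := right_ne_zero_of_mul_eq_one hzz
  set β := tBound T t with hβ
  set c := ‖T‖ with hcd
  set C₁ := c ^ t with hC₁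
  set C₂ := c ^ (1 - t) with hC₂
  have hC₁0 : 0 < C₁ := by positivity
  have hC₂0 : 0 < C₂ := by positivity
  have hCC : C₁ * C₂ = c := by
    rw [hC₁, hC₂, ← Real.rpow_add hc]; simp
  have hβe : 4 * β = 2 * numericalRadius (tAluthge T t) + (C₁ ^ 2 + C₂ ^ 2) := by
    rw [hβ, tBound, ← hcd, hC₁, hC₂, ← Real.rpow_mul_natCast hc.le, ← Real.rpow_mul_natCast hc.le]
    push_cast
    rw [show t * 2 = 2 * t by ring, show (1 - t) * 2 = 2 - 2 * t by ring]
    ring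
  have e₁ : absPow T t y = (C₁ : ℂ) • y := absPow_apply_of_eigen hPy hc.ne' ht.1
  have e₂ : absPow T (1 - t) y = (C₂ : ℂ) • y := absPow_apply_of_eigen hPy hc.ne' ht'
  have hC₁' : (C₁ : ℂ) ≠ 0 := by exact_mod_cast hC₁0.ne'
  have hC₂' : (C₂ : ℂ) ≠ 0 := by exact_mod_cast hC₂0.ne'
  have hc' : (c : ℂ) ≠ 0 := by exact_mod_cast hc.ne'
  have hCC' : (C₁ : ℂ) * C₂ = c := by exact_mod_cast hCC
  set U := polarFactor T with hU
  have hUUy : star U (U y) = y :=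
    star_polarFactor_mul_self_of_orthogonal fun k hk => inner_eq_zero_of_ker_of_abs hc.ne' hPy hk
  rw [polarizer_apply, e₁, e₂, map_smul, ← hU] at hpol
  -- These scalars come from applying `|T|^t`, respectively `|T|^(1-t)U*`, to `hpol`, since both
  -- operators send `x` to known multiples of `y` and `c = C₁C₂`.
  set κ : ℂ := star z * (2 * β - C₁ ^ 2) / c with hκ
  set κ' : ℂ := z * (2 * β - C₂ ^ 2) / c with hκ'
  have hker : T (U y - κ • y) = 0 := by
    refine apply_eq_zero_of_absPow ht ?_
    have h := congrArg (absPow T t) hpol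
    rw [map_add, map_smul, map_smul, map_smul, map_smul, e₁] at h
    have hx' : absPow T t x = (star z / 2) • y := by
      rw [hy1, smul_smul, show star z / 2 * (2 * z) = z * star z by ring, hzz, one_smul]
    rw [hx'] at h
    have h2 : absPow T t (U y) = (κ * C₁) • y := by
      have h3 : (C₂ : ℂ) • absPow T t (U y) = (C₂ : ℂ) • ((κ * C₁) • y) := by
        rw [eq_sub_of_add_eq' h, smul_smul, smul_smul, smul_smul, smul_smul, ← sub_smul]
        congr 1
        rw [hκ]
        field_simp
        rw [← hCC']
        push_cast
        ring
      exact smul_right_injective H hC₂' h3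
    rw [map_sub, map_smul, e₁, h2, smul_smul, sub_self]
  have hker' : T (star U y - κ' • y) = 0 := by
    refine apply_eq_zero_of_absPow (s := 1 - t) ⟨ht', by linarith [ht.1]⟩ ?_
    have h := congrArg (fun w => absPow T (1 - t) (star U w)) hpol
    simp only [map_add, map_smul, hUUy, e₂] at h
    have hx' : absPow T (1 - t) (star U x) = (1 / 2 : ℂ) • y := by
      rw [hy2, smul_smul]; norm_num
    rw [hx'] at h
    have h2 : absPow T (1 - t) (star U y) = (κ' * C₂) • y := by
      have h3 : (star z * C₁ : ℂ) • absPow T (1 - t) (star U y) =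
          (star z * C₁ : ℂ) • ((κ' * C₂) • y) := by
        rw [← smul_smul (star z), eq_sub_of_add_eq h]
        simp only [smul_smul]
        rw [← sub_smul]
        congr 1
        rw [hκ']
        field_simp
        rw [← hCC']
        push_cast
        linear_combination -(2 * C₁ * C₂ * (2 * β - C₂ ^ 2) : ℂ) * hzz
      exact smul_right_injective H (mul_ne_zero hzs hC₁') h3
    rw [map_sub, map_smul, e₂, h2, smul_smul, sub_self]
  -- The difference `q` lies in `ker T = ker U`, so it is orthogonal to `y` and to `U*y`, hence to
  -- itself.
  have hstar : star U y = κ' • y := by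
    rw [← sub_eq_zero]
    set q := star U y - κ' • y
    refine inner_self_eq_zero (𝕜 := ℂ) |>.1 ?_
    change inner ℂ q (star U y - κ' • y) = 0
    rw [inner_sub_right, inner_smul_right, inner_eq_zero_of_ker_of_abs hc.ne' hPy hker', inner_star_right,
      polarFactor_eq_zero_iff.2 hker']
    simp
  have hyy : (inner ℂ y y : ℂ) ≠ 0 := inner_self_ne_zero.2 hy0
  have hin : inner ℂ y (U y) = κ * inner ℂ y y := by
    have h := inner_eq_zero_of_ker_of_abs hc.ne' hPy hker
    rw [inner_eq_zero_symm, inner_sub_right, inner_smul_right, sub_eq_zero] at h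
    exact h
  have hin' : inner ℂ y (U y) = star κ' * inner ℂ y y := by
    rw [← inner_star_left, hstar, inner_smul_left]
    rfl
  -- Both scalars compute `⟨y, Uy⟩ / ⟨y, y⟩`. Comparing their formulas leaves `C₁² = C₂²`, which is
  -- the restriction on `t` and `‖T‖`.
  have hκκ : κ = star κ' := mul_right_cancel₀ hyy (hin.symm.trans hin')
  have hκ's : star κ' = star z * (2 * β - C₂ ^ 2) / c := by
    rw [hκ']
    simp
  have hC : C₁ ^ 2 = C₂ ^ 2 := by
    rw [hκ's, hκ] at hκκ
    field_simp at hκκ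
    have h : ((C₁ ^ 2 : ℝ) : ℂ) = ((C₂ ^ 2 : ℝ) : ℂ) := by
      push_cast
      linear_combination -hκκ
    exact_mod_cast h
  have hCeq : C₁ = C₂ := (sq_eq_sq₀ hC₁0.le hC₂0.le).1 hC
  have hκn : c * ‖κ‖ = numericalRadius (tAluthge T t) := by
    have h : κ = star z * ((numericalRadius (tAluthge T t) / c : ℝ) : ℂ) := by
      rw [hκ, mul_div_assoc]
      congr 1
      have : numericalRadius (tAluthge T t) = 2 * β - C₁ ^ 2 := by linarith
      rw [this]
      push_cast
      rfl
    rw [h, norm_mul, norm_star, hz, one_mul, Complex.norm_real, Real.norm_of_nonneg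
      (div_nonneg (numericalRadius_nonneg _) hc.le)]
    field_simp
  refine ⟨?_, ((‖y‖⁻¹ : ℝ) : ℂ) • y, κ, ?_, ?_, ?_, ?_, hκn⟩
  · by_cases h1 : c = 1
    · exact Or.inr h1
    · left
      have := (Real.rpow_right_inj hc h1).1 hCeq
      linarith
  · rw [norm_smul, Complex.norm_real, norm_inv, norm_norm, inv_mul_cancel₀ (norm_ne_zero_iff.2 hy0)]
  · rw [map_smul, hPy, smul_comm]
  · rw [map_smul, smul_comm κ, ← smul_sub, map_smul, hker, smul_zero]
  · rw [map_smul, hstar, smul_comm, hκκ, star_star]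

end Equality

/-! ### Orthogonal sums and reducing subspaces -/

section DirectSum

variable {H E F : Type*} [NormedAddCommGroup H] [InnerProductSpace ℂ H]
  [NormedAddCommGroup E] [InnerProductSpace ℂ E] [NormedAddCommGroup F] [InnerProductSpace ℂ F]

theorem directSum_apply (A : E →L[ℂ] E) (B : F →L[ℂ] F) (x : E) (y : F) :
    directSum A B (WithLp.toLp 2 (x, y)) = WithLp.toLp 2 (A x, B y) := rfl

/-- `J₁` and `J₂` identify `H` with the orthogonal direct sum of their domains. -/
structure IsOrthogonalSum (J₁ : E →ₗᵢ[ℂ] H) (J₂ : F →ₗᵢ[ℂ] H) : Prop where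
  inner_eq_zero : ∀ x y, inner ℂ (J₁ x) (J₂ y) = 0
  exists_eq_add : ∀ h, ∃ x y, h = J₁ x + J₂ y

namespace IsOrthogonalSum

variable {J₁ : E →ₗᵢ[ℂ] H} {J₂ : F →ₗᵢ[ℂ] H}

theorem symm (hJ : IsOrthogonalSum J₁ J₂) : IsOrthogonalSum J₂ J₁ where
  inner_eq_zero x y := inner_eq_zero_symm.1 (hJ.inner_eq_zero y x)
  exists_eq_add h := by
    obtain ⟨x, y, rfl⟩ := hJ.exists_eq_add h
    exact ⟨y, x, add_comm _ _⟩

theorem inner_add_add (hJ : IsOrthogonalSum J₁ J₂) (x x' : E) (y y' : F) :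
    inner ℂ (J₁ x + J₂ y) (J₁ x' + J₂ y') = inner ℂ x x' + inner ℂ y y' := by
  simp [hJ.inner_eq_zero, hJ.symm.inner_eq_zero]

theorem norm_add_sq (hJ : IsOrthogonalSum J₁ J₂) (x : E) (y : F) :
    ‖J₁ x + J₂ y‖ ^ 2 = ‖x‖ ^ 2 + ‖y‖ ^ 2 := by
  have h := hJ.inner_add_add x x y y
  rw [inner_self_eq_norm_sq_to_K, inner_self_eq_norm_sq_to_K, inner_self_eq_norm_sq_to_K] at h
  exact_mod_cast h

theorem norm_le (hJ : IsOrthogonalSum J₁ J₂) {T : H →L[ℂ] H} {A : E →L[ℂ] E} {B : F →L[ℂ] F}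
    (hA : ∀ x, T (J₁ x) = J₁ (A x)) (hB : ∀ y, T (J₂ y) = J₂ (B y)) {M : ℝ} (hM : 0 ≤ M)
    (hAM : ∀ x, ‖A x‖ ≤ M * ‖x‖) (hBM : ∀ y, ‖B y‖ ≤ M * ‖y‖) : ‖T‖ ≤ M := by
  refine T.opNorm_le_bound hM fun h => ?_
  obtain ⟨x, y, rfl⟩ := hJ.exists_eq_add h
  refine (sq_le_sq₀ (norm_nonneg _) (by positivity)).1 ?_
  rw [map_add, hA, hB, mul_pow, hJ.norm_add_sq, hJ.norm_add_sq]
  have h1 : ‖A x‖ ^ 2 ≤ (M * ‖x‖) ^ 2 := by gcongr; exact hAM x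
  have h2 : ‖B y‖ ^ 2 ≤ (M * ‖y‖) ^ 2 := by gcongr; exact hBM y
  linarith

theorem star_apply [CompleteSpace H] [CompleteSpace E] (hJ : IsOrthogonalSum J₁ J₂)
    {T : H →L[ℂ] H} {A : E →L[ℂ] E} {B : F →L[ℂ] F}
    (hA : ∀ x, T (J₁ x) = J₁ (A x)) (hB : ∀ y, T (J₂ y) = J₂ (B y)) (x : E) :
    star T (J₁ x) = J₁ (star A x) := by
  refine ext_inner_left ℂ fun h => ?_
  obtain ⟨x', y, rfl⟩ := hJ.exists_eq_add h
  rw [inner_star_right, map_add, hA, hB, inner_add_left, inner_add_left, hJ.symm.inner_eq_zero,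
    hJ.symm.inner_eq_zero, J₁.inner_map_map, J₁.inner_map_map, inner_star_right]

end IsOrthogonalSum

/-- The isometric embeddings of the two summands. -/
theorem UnitarilySimilar.exists_isOrthogonalSum {T : H →L[ℂ] H} {A : E →L[ℂ] E} {B : F →L[ℂ] F}
    (h : UnitarilySimilar T (directSum A B)) :
    ∃ (J₁ : E →ₗᵢ[ℂ] H) (J₂ : F →ₗᵢ[ℂ] H), IsOrthogonalSum J₁ J₂ ∧
      (∀ x, T (J₁ x) = J₁ (A x)) ∧ ∀ y, T (J₂ y) = J₂ (B y) := by
  obtain ⟨V, hV⟩ := h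
  have hV' : ∀ w, T (V.symm w) = V.symm (directSum A B w) := fun w => by
    apply V.injective
    rw [hV, V.apply_symm_apply, V.apply_symm_apply]
  let L := (WithLp.linearEquiv 2 ℂ (E × F)).symm
  let J₁ : E →ₗᵢ[ℂ] H :=
    { toLinearMap := V.symm.toLinearEquiv.toLinearMap ∘ₗ L.toLinearMap ∘ₗ LinearMap.inl ℂ E F
      norm_map' := fun x => by
        change ‖V.symm (WithLp.toLp 2 (x, 0))‖ = ‖x‖
        rw [V.symm.norm_map]
        simp }
  let J₂ : F →ₗᵢ[ℂ] H :=
    { toLinearMap := V.symm.toLinearEquiv.toLinearMap ∘ₗ L.toLinearMap ∘ₗ LinearMap.inr ℂ E F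
      norm_map' := fun x => by
        change ‖V.symm (WithLp.toLp 2 (0, x))‖ = ‖x‖
        rw [V.symm.norm_map]
        simp }
  have h₁ : ∀ x, J₁ x = V.symm (WithLp.toLp 2 (x, 0)) := fun _ => rfl
  have h₂ : ∀ y, J₂ y = V.symm (WithLp.toLp 2 (0, y)) := fun _ => rfl
  refine ⟨J₁, J₂, ⟨fun x y => ?_, fun h => ?_⟩, fun x => ?_, fun y => ?_⟩
  · rw [h₁, h₂, V.symm.inner_map_map, WithLp.prod_inner_apply]
    simp
  · refine ⟨(V h).fst, (V h).snd, ?_⟩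
    rw [h₁, h₂, ← map_add, ← WithLp.toLp_add, Prod.mk_add_mk, add_zero, zero_add]
    exact (V.symm_apply_apply h).symm
  · rw [h₁, hV', directSum_apply, map_zero, h₁]
  · rw [h₂, hV', directSum_apply, map_zero, h₂]

theorem IsOrthogonalSum.unitarilySimilar {J₁ : E →ₗᵢ[ℂ] H} {J₂ : F →ₗᵢ[ℂ] H}
    (hJ : IsOrthogonalSum J₁ J₂) {T : H →L[ℂ] H} {A : E →L[ℂ] E} {B : F →L[ℂ] F}
    (hA : ∀ x, T (J₁ x) = J₁ (A x)) (hB : ∀ y, T (J₂ y) = J₂ (B y)) :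
    UnitarilySimilar T (directSum A B) := by
  let L := WithLp.linearEquiv 2 ℂ (E × F)
  let W : WithLp 2 (E × F) →ₗᵢ[ℂ] H :=
    { toLinearMap := (J₁.toLinearMap.coprod J₂.toLinearMap) ∘ₗ L.toLinearMap
      norm_map' := fun w => by
        change ‖J₁ w.fst + J₂ w.snd‖ = ‖w‖
        rw [← sq_eq_sq₀ (norm_nonneg _) (norm_nonneg _), hJ.norm_add_sq,
          WithLp.prod_norm_sq_eq_of_L2] }
  have hW : ∀ w, W w = J₁ w.fst + J₂ w.snd := fun _ => rfl
  have hs : Function.Surjective W := fun h => by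
    obtain ⟨x, y, rfl⟩ := hJ.exists_eq_add h
    exact ⟨WithLp.toLp 2 (x, y), rfl⟩
  let V := LinearIsometryEquiv.ofSurjective W hs
  refine ⟨V.symm, fun h => ?_⟩
  apply V.injective
  rw [V.apply_symm_apply]
  obtain ⟨w, rfl⟩ := V.surjective h
  rw [V.symm_apply_apply]
  change T (W w) = W (directSum A B w)
  rw [hW, map_add, hA, hB]
  rfl

/-- A reducing subspace splits off as an orthogonal summand. -/
theorem exists_unitarilySimilar_directSum [FiniteDimensional ℂ H] [CompleteSpace H]
    [FiniteDimensional ℂ E] {T : H →L[ℂ] H} {A A' : E →L[ℂ] E} (J : E →ₗᵢ[ℂ] H)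
    (hA : ∀ x, T (J x) = J (A x)) (hA' : ∀ x, star T (J x) = J (A' x)) :
    ∃ (m : ℕ) (C : EuclideanSpace ℂ (Fin m) →L[ℂ] EuclideanSpace ℂ (Fin m)),
      UnitarilySimilar T (directSum A C) := by
  set M : Submodule ℂ H := LinearMap.range J.toLinearMap with hM
  let e := (stdOrthonormalBasis ℂ Mᗮ).repr
  let J₂ : EuclideanSpace ℂ (Fin (Module.finrank ℂ Mᗮ)) →ₗᵢ[ℂ] H :=
    Mᗮ.subtypeₗᵢ.comp e.symm.toLinearIsometry
  have hJ₂ : ∀ y, J₂ y = (e.symm y : H) := fun _ => rfl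
  have hinv : ∀ u ∈ Mᗮ, T u ∈ Mᗮ := by
    intro u hu
    rw [Submodule.mem_orthogonal]
    rintro _ ⟨x, rfl⟩
    change inner ℂ (J x) (T u) = 0
    rw [← inner_star_left, hA']
    exact (Submodule.mem_orthogonal _ _).1 hu _ ⟨_, rfl⟩
  let C₀ : Mᗮ →ₗ[ℂ] Mᗮ := T.toLinearMap.restrict hinv
  let C := LinearMap.toContinuousLinearMap
    (e.toLinearEquiv.toLinearMap ∘ₗ C₀ ∘ₗ e.symm.toLinearEquiv.toLinearMap)
  refine ⟨_, C, IsOrthogonalSum.unitarilySimilar (J₁ := J) (J₂ := J₂)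
    ⟨fun x y => ?_, fun h => ?_⟩ hA fun y => ?_⟩
  · rw [hJ₂]
    exact (Submodule.mem_orthogonal _ _).1 (e.symm y).2 _ ⟨x, rfl⟩
  · have hh : h ∈ M ⊔ Mᗮ := by
      rw [Submodule.sup_orthogonal_of_hasOrthogonalProjection]
      trivial
    obtain ⟨_, ⟨x, rfl⟩, v, hv, rfl⟩ := Submodule.mem_sup.1 hh
    refine ⟨x, e ⟨v, hv⟩, ?_⟩
    rw [hJ₂, e.symm_apply_apply]
    rfl
  · have h1 : C y = e (C₀ (e.symm y)) := rfl
    rw [hJ₂, hJ₂, h1, e.symm_apply_apply]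
    rfl

/-- The `t`-Aluthge transform of a summand. -/
theorem numericalRadius_tAluthge_le [CompleteSpace H] [CompleteSpace E]
    {T : H →L[ℂ] H} {A : E →L[ℂ] E} (J : E →ₗᵢ[ℂ] H) (hA : ∀ x, T (J x) = J (A x))
    (hA' : ∀ x, star T (J x) = J (star A x)) {t : ℝ} (ht : t ∈ Set.Icc (0 : ℝ) 1) :
    numericalRadius (tAluthge A t) ≤ numericalRadius (tAluthge T t) := by
  refine numericalRadius_le_of_forall (numericalRadius_nonneg _) fun x hx => ?_
  have h := norm_inner_le_numericalRadius (tAluthge T t) (J x)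
  have h2 := tAluthge_intertwine (J := J.toContinuousLinearMap) hA hA' ht x
  rw [LinearIsometry.coe_toContinuousLinearMap] at h2
  rwa [h2, J.inner_map_map, J.norm_map, hx, one_pow, mul_one] at h

end DirectSum

/-! ### Sufficiency of the two canonical forms, of `T² = 0` and of normaloidity -/

section Forms

variable {H : Type*} [NormedAddCommGroup H] [InnerProductSpace ℂ H] {T : H →L[ℂ] H}

theorem toEuclideanCLM_one_apply (a : ℂ) (x : EuclideanSpace ℂ (Fin 1)) :
    Matrix.toEuclideanCLM (𝕜 := ℂ) !![a] x = a • x := by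
  ext i
  fin_cases i
  simp [Matrix.ofLp_toEuclideanCLM, Matrix.mulVec, dotProduct]

theorem toEuclideanCLM_two_apply (a b : ℂ) (x : EuclideanSpace ℂ (Fin 2)) :
    Matrix.toEuclideanCLM (𝕜 := ℂ) !![a, 0; b, 0] x = x 0 • !₂[a, b] := by
  ext i
  fin_cases i <;> simp [Matrix.ofLp_toEuclideanCLM, Matrix.mulVec, dotProduct, mul_comm]

theorem HasFormOne.numericalRadius_eq_norm (h : HasFormOne T) : numericalRadius T = ‖T‖ := by
  obtain ⟨m, a, B, hs, hB⟩ := h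
  obtain ⟨J₁, J₂, hJ, hA, hB'⟩ := hs.exists_isOrthogonalSum
  refine le_antisymm (numericalRadius_le_norm T) ?_
  have h1 : ‖T‖ ≤ ‖a‖ := by
    refine hJ.norm_le hA hB' (norm_nonneg a) (fun x => ?_) fun y => B.le_of_opNorm_le hB y
    rw [toEuclideanCLM_one_apply, norm_smul]
  refine h1.trans ?_
  set e : EuclideanSpace ℂ (Fin 1) := EuclideanSpace.single 0 1
  have he : ‖e‖ = 1 := by simp [e]
  have h2 := norm_inner_le_numericalRadius T (J₁ e)
  rw [hA, toEuclideanCLM_one_apply, map_smul, inner_smul_right, inner_self_eq_norm_sq_to_K,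
    J₁.norm_map, he] at h2
  simpa using h2

/-- The numerical radius of `[[a, 0], [b, 0]]` from below. -/
theorem le_numericalRadius_of_block {e f : H} (he : ‖e‖ = 1) (hf : ‖f‖ = 1)
    (hef : inner ℂ e f = 0) {a b : ℂ} (hTe : T e = a • e + b • f) (hTf : T f = 0) :
    (‖a‖ + √(‖a‖ ^ 2 + ‖b‖ ^ 2)) / 2 ≤ numericalRadius T := by
  set c := √(‖a‖ ^ 2 + ‖b‖ ^ 2) with hc
  have hc2 : c ^ 2 = ‖a‖ ^ 2 + ‖b‖ ^ 2 := Real.sq_sqrt (by positivity)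
  have hc0 : 0 ≤ c := Real.sqrt_nonneg _
  rcases hc0.eq_or_lt with h0 | h0
  · have : ‖a‖ = 0 := by
      rw [← h0] at hc2
      nlinarith [sq_nonneg ‖a‖, sq_nonneg ‖b‖]
    rw [← h0, this]
    simpa using numericalRadius_nonneg T
  obtain ⟨μ, hμ, hμa⟩ := exists_norm_one_mul_eq_norm a
  have hμμ : μ * star μ = 1 := by
    rw [Complex.star_def, Complex.mul_conj, Complex.normSq_eq_norm_sq, hμ]; simp
  set p : ℝ := ‖a‖ + c with hp
  have hp0 : 0 < p := by positivity
  -- The vector `(p, μb)` is the top eigenvector of the real part of the rotated block `[[|a|, 0],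
  -- [μb, 0]]`, whose top eigenvalue is `p / 2`.
  set x : H := (p : ℂ) • e + (μ * b) • f with hx
  have hfe : inner ℂ f e = 0 := inner_eq_zero_symm.1 hef
  have hee : (inner ℂ e e : ℂ) = 1 := by rw [inner_self_eq_norm_sq_to_K, he]; simp
  have hff : (inner ℂ f f : ℂ) = 1 := by rw [inner_self_eq_norm_sq_to_K, hf]; simp
  have hbb : star b * b = ((‖b‖ ^ 2 : ℝ) : ℂ) := by
    rw [Complex.star_def, mul_comm, Complex.mul_conj, Complex.normSq_eq_norm_sq]
  have hTx : T x = (p : ℂ) • (a • e + b • f) := by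
    rw [hx, map_add, map_smul, map_smul, hTe, hTf, smul_zero, add_zero]
  have hxx : ((‖x‖ ^ 2 : ℝ) : ℂ) = ((p ^ 2 + ‖b‖ ^ 2 : ℝ) : ℂ) := by
    have h1 : (inner ℂ x x : ℂ) = ((‖x‖ ^ 2 : ℝ) : ℂ) := by
      rw [inner_self_eq_norm_sq_to_K]; simp
    rw [← h1, hx]
    simp only [inner_add_left, inner_add_right, inner_smul_left, inner_smul_right, hee, hff, hef,
      hfe, map_mul, Complex.conj_ofReal, ← Complex.star_def]
    push_cast at hbb ⊢
    linear_combination hbb + (star b * b) * hμμ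
  have hxT : μ * inner ℂ x (T x) = ((p * (‖a‖ * p + ‖b‖ ^ 2) : ℝ) : ℂ) := by
    rw [hTx, hx]
    simp only [inner_add_left, inner_add_right, inner_smul_left, inner_smul_right, hee, hff, hef,
      hfe, map_mul, Complex.conj_ofReal, ← Complex.star_def]
    push_cast at hbb ⊢
    linear_combination (p : ℂ) ^ 2 * hμa + (p : ℂ) * hbb + (p : ℂ) * star b * b * hμμ
  have hxx' : ‖x‖ ^ 2 = p ^ 2 + ‖b‖ ^ 2 := by exact_mod_cast hxx
  have h1 := norm_inner_le_numericalRadius T x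
  have h2 : ‖(inner ℂ x (T x) : ℂ)‖ = p * (‖a‖ * p + ‖b‖ ^ 2) := by
    have := congrArg norm hxT
    rwa [norm_mul, hμ, one_mul, Complex.norm_real, Real.norm_of_nonneg (by positivity)] at this
  rw [h2, hxx'] at h1
  have h3 : p * (‖a‖ * p + ‖b‖ ^ 2) = p / 2 * (p ^ 2 + ‖b‖ ^ 2) := by
    have : ‖b‖ ^ 2 = c ^ 2 - ‖a‖ ^ 2 := by linarith
    rw [this, hp]
    ring
  rw [h3] at h1
  exact le_of_mul_le_mul_right h1 (by positivity)

variable [CompleteSpace H]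

/-- On the range of `|T|`, commuting `|T|` past `|T|^(1/2)` produces `|T|^(1/2) T (·)`; the range of
`T` lies in `ker T`, which `|T|^(1/2)` annihilates. -/
theorem aluthge_eq_zero_of_mul_self_eq_zero (h : T * T = 0) : aluthge T = 0 := by
  have hTT : ∀ x, T (T x) = 0 := fun x => by
    rw [← mul_apply_eq_comp, h, zero_apply]
  have hR : absPow T (1 / 2) * absPow T (1 / 2) = CFC.abs T :=
    absPow_mul_absPow T (by norm_num) (by norm_num) (by norm_num)
  rw [← tAluthge_half, tAluthge, show (1 - 1 / 2 : ℝ) = 1 / 2 by norm_num]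
  refine eq_of_eqOn_ker_of_eqOn_range_abs T (fun x hx => ?_) fun x => ?_
  · simp [absPow_apply_of_ker hx (show (0 : ℝ) ≤ 2⁻¹ by norm_num)]
  · have h1 : absPow T (1 / 2) (CFC.abs T x) = CFC.abs T (absPow T (1 / 2) x) := by
      rw [← hR]
      rfl
    rw [mul_apply_eq_comp, mul_apply_eq_comp, h1, polarFactor_abs, zero_apply]
    exact absPow_apply_of_ker (hTT _) (by norm_num)

theorem norm_aluthge_le (T : H →L[ℂ] H) : ‖aluthge T‖ ≤ ‖T‖ := by
  have h1 : ‖absPow T (1 / 2)‖ ≤ ‖T‖ ^ (1 / 2 : ℝ) := norm_absPow_le T (by norm_num)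
  have h2 := norm_polarFactor_le_one T
  rw [← tAluthge_half, tAluthge, show (1 - 1 / 2 : ℝ) = 1 / 2 by norm_num]
  calc _ ≤ ‖absPow T (1 / 2)‖ * ‖polarFactor T‖ * ‖absPow T (1 / 2)‖ :=
        (norm_mul_le _ _).trans (by gcongr; exact norm_mul_le _ _)
    _ ≤ ‖T‖ ^ (1 / 2 : ℝ) * 1 * ‖T‖ ^ (1 / 2 : ℝ) := by gcongr
    _ = ‖T‖ := by
      rw [mul_one, ← Real.rpow_add_of_nonneg (norm_nonneg T) (by norm_num) (by norm_num)]
      norm_num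

theorem isLeast_tBound_of_eq {t : ℝ} (ht : t ∈ Set.Icc (0 : ℝ) 1)
    (h : numericalRadius T = tBound T t) :
    IsLeast (tBound T '' Set.Icc 0 1) (numericalRadius T) :=
  ⟨⟨t, ht, h.symm⟩, by
    rintro _ ⟨s, hs, rfl⟩
    exact numericalRadius_le_tBound T hs⟩

theorem eq_tBound_half_of_normaloid (h : numericalRadius T = ‖T‖) :
    numericalRadius T = tBound T (1 / 2) := by
  refine le_antisymm (numericalRadius_le_tBound T half_mem_Icc) ?_
  have h1 := (numericalRadius_le_norm (aluthge T)).trans (norm_aluthge_le T)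
  rw [tBound_half]
  linarith

/-- The Aluthge transform vanishes, so the bound is `‖T‖ / 2`, which never exceeds `w(T)`. -/
theorem eq_tBound_half_of_mul_self_eq_zero (h : T * T = 0) :
    numericalRadius T = tBound T (1 / 2) := by
  refine le_antisymm (numericalRadius_le_tBound T half_mem_Icc) ?_
  rw [tBound_half, aluthge_eq_zero_of_mul_self_eq_zero h, numericalRadius_zero]
  linarith [norm_le_two_mul_numericalRadius T]

theorem HasFormTwo.eq_tBound {t : ℝ} (ht : t ∈ Set.Icc (0 : ℝ) 1) (ht' : t = 1 / 2 ∨ ‖T‖ = 1)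
    (h : HasFormTwo T t) : numericalRadius T = tBound T t := by
  obtain ⟨m, a, b, C, hs, hC, hw⟩ := h
  obtain ⟨J₁, J₂, hJ, hA, hC'⟩ := hs.exists_isOrthogonalSum
  set c := √(‖a‖ ^ 2 + ‖b‖ ^ 2) with hc
  have hc2 : c ^ 2 = ‖a‖ ^ 2 + ‖b‖ ^ 2 := Real.sq_sqrt (by positivity)
  have hc0 : 0 ≤ c := Real.sqrt_nonneg _
  have hab : ‖(!₂[a, b] : EuclideanSpace ℂ (Fin 2))‖ = c := by
    simp [EuclideanSpace.norm_eq, hc]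
  set e := J₁ (EuclideanSpace.single 0 1) with he
  set f := J₁ (EuclideanSpace.single 1 1) with hf
  have he1 : ‖e‖ = 1 := by rw [he, J₁.norm_map]; simp
  have hf1 : ‖f‖ = 1 := by rw [hf, J₁.norm_map]; simp
  have hef : inner ℂ e f = 0 := by
    rw [he, hf, J₁.inner_map_map]; simp [EuclideanSpace.inner_single_left]
  have hJ₁ : ∀ x, J₁ x = x 0 • e + x 1 • f := fun x => by
    rw [he, hf, ← map_smul, ← map_smul, ← map_add]
    congr 1
    ext i
    fin_cases i <;> simp
  have hTJ : ∀ x, T (J₁ x) = x 0 • (a • e + b • f) := fun x => by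
    rw [hA, toEuclideanCLM_two_apply, map_smul, hJ₁]
    simp
  have hTe : T e = a • e + b • f := by
    have h := hTJ (EuclideanSpace.single 0 1)
    rw [← he] at h
    simpa using h
  have hTf : T f = 0 := by
    rw [hf, hTJ]; simp
  have hTn : ‖T e‖ = c := by
    rw [he, hA, toEuclideanCLM_two_apply, J₁.norm_map, norm_smul, hab]; simp
  have hn : ‖T‖ = c := by
    refine le_antisymm ?_ ?_
    · refine hJ.norm_le hA hC' hc0 (fun x => ?_) fun y => C.le_of_opNorm_le hC y
      rw [toEuclideanCLM_two_apply, norm_smul, hab, mul_comm]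
      gcongr
      exact PiLp.norm_apply_le x 0
    · rw [← hTn]
      exact T.le_opNorm_of_le he1.le |>.trans_eq (mul_one _)
  rcases eq_or_ne T 0 with rfl | hT
  · rcases ht' with rfl | h1
    · rw [tBound_zero_half, numericalRadius_zero]
    · simp at h1
  have hcp : 0 < c := hn ▸ norm_pos_iff.2 hT
  have hPe : CFC.abs T e = (c : ℂ) • e := by
    rw [← hn]
    exact abs_eq_smul_of_norm_eq (by rw [he1, mul_one, hTn, hn])
  have hUe : (c : ℂ) • polarFactor T e = a • e + b • f := by
    rw [← map_smul, ← hPe, polarFactor_abs, hTe]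
  have ht1 : 0 ≤ 1 - t := by linarith [ht.2]
  -- `Ue = (ae + bf)/c`; the outer power kills `f ∈ ker T`, and the scalars on `e` multiply to
  -- `c^(1-t) c⁻¹ c^t = 1`. So the block contributes `[a] ⊕ [0]` to the transform.
  have hAe : tAluthge T t e = a • e := by
    rw [tAluthge, mul_apply_eq_comp, mul_apply_eq_comp, absPow_apply_of_eigen hPe hcp.ne' ht1]
    have hU : polarFactor T e = (c : ℂ)⁻¹ • (a • e + b • f) := by
      rw [← hUe, inv_smul_smul₀ (by exact_mod_cast hcp.ne')]
    rw [map_smul, map_smul, hU, map_smul, map_add, map_smul, map_smul,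
      absPow_apply_of_ker hTf ht.1, absPow_apply_of_eigen hPe hcp.ne' ht.1, smul_zero, add_zero,
      smul_comm a, smul_smul, smul_smul]
    have h1 : c ^ (1 - t) * (c⁻¹ * c ^ t) = 1 := by
      rw [mul_left_comm, ← Real.rpow_add hcp, sub_add_cancel, Real.rpow_one,
        inv_mul_cancel₀ hcp.ne']
    have h2 : ((c ^ (1 - t) : ℝ) : ℂ) * ((c : ℂ)⁻¹ * ((c ^ t : ℝ) : ℂ)) = 1 := by exact_mod_cast h1
    rw [mul_assoc, h2, one_smul]
  have hAf : tAluthge T t f = 0 := by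
    rw [tAluthge, mul_apply_eq_comp, mul_apply_eq_comp, absPow_apply_of_ker hTf ht1, map_zero,
      map_zero]
  have hAJ : ∀ x, tAluthge T t (J₁ x) = J₁ ((a * x 0) • EuclideanSpace.single 0 1) := fun x => by
    rw [map_smul, ← he, hJ₁, map_add, map_smul, map_smul, hAe, hAf, smul_zero, add_zero,
      smul_smul, mul_comm]
  have hAJ₂ : ∀ y, tAluthge T t (J₂ y) = J₂ (tAluthge C t y) :=
    tAluthge_intertwine (J := J₂.toContinuousLinearMap) hC' (hJ.symm.star_apply hC' hA) ht
  have hwa : numericalRadius (tAluthge T t) ≤ ‖a‖ := by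
    refine numericalRadius_le_of_forall (norm_nonneg a) fun h hh => ?_
    obtain ⟨x, y, rfl⟩ := hJ.exists_eq_add h
    have hxy := hJ.norm_add_sq x y
    rw [hh] at hxy
    rw [map_add, hAJ, hAJ₂, hJ.inner_add_add]
    have k1 : ‖(inner ℂ x ((a * x 0) • EuclideanSpace.single (0 : Fin 2) (1 : ℂ)) : ℂ)‖ ≤
        ‖a‖ * ‖x‖ ^ 2 := by
      rw [inner_smul_right, EuclideanSpace.inner_single_right, one_mul, norm_mul, norm_mul,
        RCLike.norm_conj, mul_assoc, ← sq]
      gcongr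
      exact PiLp.norm_apply_le x 0
    have k2 : ‖(inner ℂ y (tAluthge C t y) : ℂ)‖ ≤ ‖a‖ * ‖y‖ ^ 2 :=
      (norm_inner_le_numericalRadius _ y).trans (by gcongr)
    refine (norm_add_le _ _).trans ((add_le_add k1 k2).trans_eq ?_)
    rw [← mul_add, ← hxy]
    ring
  refine le_antisymm (numericalRadius_le_tBound T ht) ?_
  refine le_trans ?_ (le_numericalRadius_of_block he1 hf1 hef hTe hTf)
  -- The restriction `t = 1/2` or `‖T‖ = 1` is used here: both powers then equal `‖T‖ = c`.
  have hpow : ‖T‖ ^ (2 * t) + ‖T‖ ^ (2 - 2 * t) = 2 * c := by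
    rcases ht' with rfl | h1
    · rw [hn]
      norm_num
      ring
    · rw [← hn, h1]
      norm_num
  rw [tBound, hpow, ← hc]
  linarith

end Forms

/-! ### Necessity of the canonical forms in finite dimension -/

section FiniteDimensional

variable {H : Type*} [NormedAddCommGroup H] [InnerProductSpace ℂ H] [FiniteDimensional ℂ H]

theorem exists_norm_inner_eq_numericalRadius [Nontrivial H] (T : H →L[ℂ] H) :
    ∃ x : H, ‖x‖ = 1 ∧ ‖(inner ℂ x (T x) : ℂ)‖ = numericalRadius T := by
  have : ProperSpace H := FiniteDimensional.proper ℂ H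
  obtain ⟨x₀, hx₀⟩ := exists_norm_eq H zero_le_one
  obtain ⟨x, hx, hmax⟩ := (isCompact_sphere (0 : H) 1).exists_isMaxOn ⟨x₀, by simpa using hx₀⟩
    (f := fun x => ‖(inner ℂ x (T x) : ℂ)‖) (by fun_prop)
  have hx1 : ‖x‖ = 1 := by simpa using hx
  refine ⟨x, hx1, le_antisymm ?_ ?_⟩
  · simpa [hx1] using norm_inner_le_numericalRadius T x
  · exact numericalRadius_le_of_forall (norm_nonneg _) fun y hy => hmax (by simpa using hy)

variable [CompleteSpace H] {T : H →L[ℂ] H}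

theorem hasFormOne_of_eigenvector {e : H} (he : ‖e‖ = 1) {α : ℂ} (hTe : T e = α • e)
    (hα : ‖T‖ = ‖α‖) : HasFormOne T := by
  have hee : (inner ℂ e e : ℂ) = 1 := by rw [inner_self_eq_norm_sq_to_K, he]; simp
  -- An eigenvalue of modulus `‖T‖` is a reducing one: expanding gives `‖T*e - ᾱe‖² ≤ |α|² - 2|α|² +
  -- |α|² = 0`.
  have hstar : star T e = star α • e := by
    have h1 : ‖star T e‖ ≤ ‖α‖ := by
      refine ((star T).le_opNorm e).trans ?_
      rw [norm_star, hα, he, mul_one]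
    have h2 : RCLike.re (inner ℂ (star T e) (star α • e) : ℂ) = ‖α‖ ^ 2 := by
      rw [inner_smul_right, inner_star_left, hTe, inner_smul_right, hee, mul_one,
        Complex.star_def, mul_comm, Complex.mul_conj, Complex.normSq_eq_norm_sq]
      simp only [RCLike.re_to_complex, Complex.ofReal_re]
    rw [← sub_eq_zero, ← norm_eq_zero, ← sq_eq_zero_iff]
    refine le_antisymm ?_ (sq_nonneg _)
    rw [norm_sub_sq (𝕜 := ℂ), h2, norm_smul, norm_star, he, mul_one]
    have : ‖star T e‖ ^ 2 ≤ ‖α‖ ^ 2 := by gcongr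
    linarith
  let J : EuclideanSpace ℂ (Fin 1) →ₗᵢ[ℂ] H :=
    { toLinearMap := (EuclideanSpace.proj (0 : Fin 1)).toLinearMap.smulRight e
      norm_map' := fun x => by
        change ‖x 0 • e‖ = ‖x‖
        rw [norm_smul, he, EuclideanSpace.norm_eq]
        simp }
  have hJ : ∀ x, J x = x 0 • e := fun _ => rfl
  obtain ⟨m, B, hB⟩ := exists_unitarilySimilar_directSum (T := T)
    (A := Matrix.toEuclideanCLM (𝕜 := ℂ) !![α]) (A' := Matrix.toEuclideanCLM (𝕜 := ℂ) !![star α]) J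
    (fun x => by rw [toEuclideanCLM_one_apply, map_smul, hJ, map_smul, hTe, smul_comm])
    (fun x => by rw [toEuclideanCLM_one_apply, map_smul, hJ, map_smul, hstar, smul_comm])
  refine ⟨m, α, B, hB, ?_⟩
  obtain ⟨J₁, J₂, hJ', hA, hB'⟩ := hB.exists_isOrthogonalSum
  refine B.opNorm_le_bound (norm_nonneg α) fun y => ?_
  rw [← J₂.norm_map, ← hB', ← hα, ← J₂.norm_map y]
  exact T.le_opNorm _

/-- The vectors `y` and `f = g/‖g‖`, `g = Uy - κy ∈ ker T`, are orthonormal and span a reducing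
subspace: `Ty = c(κy + df)` and `Tf = 0`, while `T*` sends both into `ℂy`. Since `‖Uy‖ = 1`, `|κ|² +
d² = 1`, so the block has norm `c`. -/
theorem hasFormTwo_of_reducing_vector {t : ℝ} (ht : t ∈ Set.Icc (0 : ℝ) 1) {y : H} {κ : ℂ}
    (hy : ‖y‖ = 1) (hT : T ≠ 0) (hPy : CFC.abs T y = (‖T‖ : ℂ) • y)
    (hker : T (polarFactor T y - κ • y) = 0) (hstar : star (polarFactor T) y = star κ • y)
    (hκ : ‖T‖ * ‖κ‖ = numericalRadius (tAluthge T t))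
    (hne : polarFactor T y - κ • y ≠ 0) : HasFormTwo T t := by
  have hc : 0 < ‖T‖ := norm_pos_iff.2 hT
  set c := ‖T‖ with hcd
  set U := polarFactor T with hU
  have hort : ∀ k, T k = 0 → inner ℂ k y = 0 := fun k hk =>
    inner_eq_zero_of_ker_of_abs hc.ne' hPy hk
  have hyy : (inner ℂ y y : ℂ) = 1 := by rw [inner_self_eq_norm_sq_to_K, hy]; simp
  have hUy : ‖U y‖ = 1 := by rw [← hy]; exact norm_polarFactor_of_orthogonal hort
  have hUUy : star U (U y) = y := star_polarFactor_mul_self_of_orthogonal hort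
  have hTy : T y = (c : ℂ) • U y := by
    rw [← polarFactor_abs, hPy, map_smul]
  set g := U y - κ • y with hg
  have hgn : 0 < ‖g‖ := norm_pos_iff.2 hne
  set d := ‖g‖ with hd
  have hd' : (d : ℂ) ≠ 0 := by exact_mod_cast hgn.ne'
  have hyg : inner ℂ y g = 0 := inner_eq_zero_symm.1 (hort g hker)
  have hUg : U y = κ • y + g := by rw [hg]; abel
  have hκd : ‖κ‖ ^ 2 + d ^ 2 = 1 := by
    have h := norm_add_sq_eq_norm_sq_add_norm_sq_of_inner_eq_zero (𝕜 := ℂ) (κ • y) g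
      (by rw [inner_smul_left, hyg, mul_zero])
    rw [← hUg, hUy, norm_smul, hy] at h
    linarith
  have hstarT : ∀ x, star T x = CFC.abs T (star U x) := fun x => by
    have h : star T = CFC.abs T * star U := by
      conv_lhs => rw [(polarFactor_spec T).2.1]
      rw [star_mul, abs_star_eq]
    rw [h, mul_apply_eq_comp]
  have hTsy : star T y = (star κ * c) • y := by
    rw [hstarT, hstar, map_smul, hPy, smul_smul]
  have hTsU : star T (U y) = (c : ℂ) • y := by rw [hstarT, hUUy, hPy]
  have hTsg : star T g = (c * (1 - κ * star κ)) • y := by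
    rw [hg, map_sub, map_smul, hTsy, hTsU, smul_smul, ← sub_smul]
    congr 1
    ring
  set f := (d : ℂ)⁻¹ • g with hf
  have hgf : g = (d : ℂ) • f := by rw [hf, smul_inv_smul₀ hd']
  have hfn : ‖f‖ = 1 := by
    rw [hf, norm_smul, norm_inv, Complex.norm_real, Real.norm_of_nonneg hgn.le, ← hd,
      inv_mul_cancel₀ hgn.ne']
  have hyf : inner ℂ y f = 0 := by rw [hf, inner_smul_right, hyg, mul_zero]
  have hTf : T f = 0 := by rw [hf, map_smul, hker, smul_zero]
  let J : EuclideanSpace ℂ (Fin 2) →ₗᵢ[ℂ] H :=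
    { toLinearMap := (EuclideanSpace.proj (0 : Fin 2)).toLinearMap.smulRight y +
        (EuclideanSpace.proj (1 : Fin 2)).toLinearMap.smulRight f
      norm_map' := fun x => by
        change ‖x 0 • y + x 1 • f‖ = ‖x‖
        have h := norm_add_sq_eq_norm_sq_add_norm_sq_of_inner_eq_zero (𝕜 := ℂ) (x 0 • y)
          (x 1 • f) (by rw [inner_smul_left, inner_smul_right, hyf, mul_zero, mul_zero])
        rw [← sq_eq_sq₀ (norm_nonneg _) (norm_nonneg _), EuclideanSpace.norm_sq_eq,
          Fin.sum_univ_two, sq, h, norm_smul, norm_smul, hy, hfn]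
        ring }
  have hJ : ∀ x, J x = x 0 • y + x 1 • f := fun _ => rfl
  obtain ⟨m, C, hC⟩ := exists_unitarilySimilar_directSum (T := T)
    (A := Matrix.toEuclideanCLM (𝕜 := ℂ) !![c * κ, 0; c * d, 0])
    (A' := Matrix.toEuclideanCLM (𝕜 := ℂ)
      !![star κ * c, (d : ℂ)⁻¹ * (c * (1 - κ * star κ)); 0, 0]) J
    (fun x => by
      rw [toEuclideanCLM_two_apply, map_smul, hJ, hJ, map_add, map_smul, map_smul, hTy, hTf, hUg,
        hgf, smul_zero, add_zero, smul_add, smul_smul, smul_smul]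
      simp)
    (fun x => by
      have h : Matrix.toEuclideanCLM (𝕜 := ℂ)
          !![star κ * c, (d : ℂ)⁻¹ * (c * (1 - κ * star κ)); 0, 0] x =
          !₂[star κ * c * x 0 + (d : ℂ)⁻¹ * (c * (1 - κ * star κ)) * x 1, 0] := by
        ext i
        fin_cases i <;> simp [Matrix.ofLp_toEuclideanCLM, Matrix.mulVec, dotProduct]
      rw [h, hJ, hJ, map_add, map_smul, map_smul, hTsy, hf, map_smul, hTsg, smul_smul, smul_smul,
        smul_smul, ← add_smul]
      simp only [Matrix.cons_val_zero, Matrix.cons_val_one, zero_smul, add_zero]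
      congr 1
      ring)
  obtain ⟨J₁, J₂, hJ', hA, hC'⟩ := hC.exists_isOrthogonalSum
  have ha : ‖(c * κ : ℂ)‖ = c * ‖κ‖ := by
    rw [norm_mul, Complex.norm_real, Real.norm_of_nonneg hc.le]
  refine ⟨m, c * κ, c * d, C, hC, ?_, ?_⟩
  · have hs : √(‖(c * κ : ℂ)‖ ^ 2 + ‖(c * d : ℂ)‖ ^ 2) = c := by
      rw [ha, norm_mul, Complex.norm_real, Complex.norm_real, Real.norm_of_nonneg hc.le,
        Real.norm_of_nonneg hgn.le, mul_pow, mul_pow, ← mul_add, hκd, mul_one, Real.sqrt_sq hc.le]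
    rw [hs]
    refine C.opNorm_le_bound hc.le fun w => ?_
    rw [← J₂.norm_map, ← hC', ← J₂.norm_map w]
    exact T.le_opNorm _
  · rw [ha, hκ]
    exact numericalRadius_tAluthge_le J₂ hC' (hJ'.symm.star_apply hC' hA) ht

theorem hasForm_of_eq_tBound [Nontrivial H] {t : ℝ} (ht : t ∈ Set.Icc (0 : ℝ) 1)
    (h : numericalRadius T = tBound T t) :
    HasFormOne T ∨ (t = 1 / 2 ∨ ‖T‖ = 1) ∧ HasFormTwo T t := by
  rcases eq_or_ne T 0 with rfl | hT
  -- The zero operator has form (A) with `a = 0`; a unit vector exists because `H` is nonzero.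
  · obtain ⟨e, he⟩ := exists_norm_eq H zero_le_one
    exact Or.inl (hasFormOne_of_eigenvector he (α := 0) (by simp) (by simp))
  obtain ⟨x, hx, hxw⟩ := exists_norm_inner_eq_numericalRadius T
  obtain ⟨z, hz, hzx⟩ := exists_norm_one_mul_eq_norm (inner ℂ x (T x))
  obtain ⟨ht', y, κ, hy, hPy, hker, hstar, hκ⟩ := exists_reducing_vector hT ht hz hx
    (by rw [hzx, Complex.ofReal_re, hxw, h])
  by_cases hg : polarFactor T y - κ • y = 0
  · left
    have hUy := sub_eq_zero.1 hg
    have hc : ‖T‖ ≠ 0 := norm_ne_zero_iff.2 hT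
    have hκ1 : ‖κ‖ = 1 := by
      have h1 : ‖polarFactor T y‖ = ‖y‖ := norm_polarFactor_of_orthogonal fun k hk =>
        inner_eq_zero_of_ker_of_abs hc hPy hk
      rwa [hUy, norm_smul, hy, mul_one] at h1
    refine hasFormOne_of_eigenvector hy (α := ‖T‖ * κ) ?_ ?_
    · rw [← polarFactor_abs, hPy, map_smul, hUy, smul_smul]
    · simp [hκ1]
  · exact Or.inr ⟨ht', hasFormTwo_of_reducing_vector ht hy hT hPy hker hstar hκ hg⟩

end FiniteDimensional

end NumRadius

/-! ### The main theorem -/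

theorem mainTheorem7 {H : Type*} [NormedAddCommGroup H] [InnerProductSpace ℂ H] [CompleteSpace H]
    (T : H →L[ℂ] H) :
    -- (i) the minimum exists and bounds `w(T)`; the case `t = 1/2`
    ((∃ m : ℝ, IsLeast (NumRadius.tBound T '' Set.Icc 0 1) m ∧ NumRadius.numericalRadius T ≤ m) ∧
      NumRadius.numericalRadius T ≤
        1 / 2 * NumRadius.numericalRadius (NumRadius.aluthge T) + 1 / 2 * ‖T‖) ∧
    -- (ii) the equality cases on a nonzero finite-dimensional space
    (FiniteDimensional ℂ H → Nontrivial H →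
      (IsLeast (NumRadius.tBound T '' Set.Icc 0 1) (NumRadius.numericalRadius T) ↔
        NumRadius.HasFormOne T ∨
          ∃ t ∈ Set.Icc (0 : ℝ) 1, (t = 1 / 2 ∨ ‖T‖ = 1) ∧ NumRadius.HasFormTwo T t) ∧
      (NumRadius.numericalRadius T =
          1 / 2 * NumRadius.numericalRadius (NumRadius.aluthge T) + 1 / 2 * ‖T‖ ↔
        NumRadius.HasFormOne T ∨ NumRadius.HasFormTwo T (1 / 2))) ∧
    -- (iii) sufficient conditions for both equalities on an arbitrary Hilbert space
    (T * T = 0 ∨ NumRadius.numericalRadius T = ‖T‖ →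
      IsLeast (NumRadius.tBound T '' Set.Icc 0 1) (NumRadius.numericalRadius T) ∧
      NumRadius.numericalRadius T =
        1 / 2 * NumRadius.numericalRadius (NumRadius.aluthge T) + 1 / 2 * ‖T‖) := by
  rw [← NumRadius.tBound_half]
  refine ⟨⟨?_, NumRadius.numericalRadius_le_tBound T NumRadius.half_mem_Icc⟩, ?_, ?_⟩
  · obtain ⟨m, hm⟩ := NumRadius.exists_isLeast_tBound T
    obtain ⟨t, ht, rfl⟩ := hm.1
    exact ⟨_, hm, NumRadius.numericalRadius_le_tBound T ht⟩
  · intro _ _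
    refine ⟨⟨?_, ?_⟩, ⟨?_, ?_⟩⟩
    · rintro ⟨⟨t, ht, h⟩, -⟩
      exact (NumRadius.hasForm_of_eq_tBound ht h.symm).imp_right fun h' => ⟨t, ht, h'⟩
    · rintro (h | ⟨t, ht, ht', h⟩)
      · exact NumRadius.isLeast_tBound_of_eq NumRadius.half_mem_Icc
          (NumRadius.eq_tBound_half_of_normaloid h.numericalRadius_eq_norm)
      · exact NumRadius.isLeast_tBound_of_eq ht (h.eq_tBound ht ht')
    · exact fun h => (NumRadius.hasForm_of_eq_tBound NumRadius.half_mem_Icc h).imp_right And.right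
    · rintro (h | h)
      · exact NumRadius.eq_tBound_half_of_normaloid h.numericalRadius_eq_norm
      · exact h.eq_tBound NumRadius.half_mem_Icc (Or.inl rfl)
  · intro h
    have key : NumRadius.numericalRadius T = NumRadius.tBound T (1 / 2) :=
      h.elim NumRadius.eq_tBound_half_of_mul_self_eq_zero NumRadius.eq_tBound_half_of_normaloid
    exact ⟨NumRadius.isLeast_tBound_of_eq NumRadius.half_mem_Icc key, key⟩
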